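/- Let $\ell\ge 2$, $\mathcal S=\{0,\dots,\ell-1\}$, and for a word $\varepsilon_1\cdots\varepsilon_n$ over $\mathcal S$ let $I_{\varepsilon_1\cdots\varepsilon_n}=\big[\sum_{i=1}^n \varepsilon_i\ell^{-i},\ \sum_{i=1}^n \varepsilon_i\ell^{-i}+\ell^{-n}\big)$; let $\mathcal F_n$ be the set of these intervals of order $n$. Let $P_0=(p^0_{ij})_{i,j\in\mathcal S}$ be an irreducible matrix with entries in $\{0,1\}$, let $p^0=(p^0_i)_{i\in\mathcal S}$ be a nonzero vector with entries in $\{0,1\}$, and define the compact set $$K=\bigcap_{n\ge 1}\ \bigcup_{p^0_{\varepsilon_1}p^0_{\varepsilon_1\varepsilon_2}\cdots p^0_{\varepsilon_{n-1}\varepsilon_n}=1}\overline{I_{\varepsilon_1\cdots\varepsilon_n}},\qquad \delta=\dim_H K .$$ Let $(X_n)_{n\ge1}$ be a Markov chain on $\mathcal S$ with irreducible transition matrix $P=(p_{ij})$ such that $p_{ij}\ne 1$ for all $i,j$, and let $m$ be the Borel probability measure on $\mathbb R$ driven by it, i.e. $m(I_{\varepsilon_1\cdots\varepsilon_n})=\mathbb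 P(X_1=\varepsilon_1,\dots,X_n=\varepsilon_n)$ for all words. Assume that the support of $m$ is $K$. Conventions. For a Borel probability measure $\mu$ on $\mathbb R$ put $\dim_*\mu=\inf\{\dim_H E:\mu(E)>0\}$ and $\dim^*\mu=\inf\{\dim_H E:\mu(E)=1\}$ ($E$ Borel); if they agree, $\mu$ is unidimensional and the common value is $\dim\mu$. For $\alpha\in\mathbb R$ let $E_\alpha$ be the set of $x\in\operatorname{supp} m$ with $\lim_{r\to0^+}\log m(B(x,r))/\log r=\alpha$. The measure $m$ is monofractal if $E_\alpha=\operatorname{supp}m$ for some $\alpha\in\mathbb R$, and multifractal if $\dim_H E_\alpha>0$ for at least two values of $\alpha\in\mathbb R$. Finally let $\tau(q)=\limsup_{n\to\infty}\frac1{n\log\ell}\log\sum_{I\in\mathcal F_n}m(I)^q$ with $0^q=0$. Then, with $\lambda_0$ the spectral radius of $P_0$, there is a unique probability vector $\pi_0$ with $P_0\pi_0=\lambda_0\pi_0$, and its entries are positive. Let $D_0$ be the diagonal matrix with diagonal $\pi_0$. The measure $m$ is unidimensional, and $$\dim m=\delta\iff P=\frac1{\lambda_0}D_0^{-1}P_0D_0\iff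 m\text{ is monofractal}.$$ If $P\neq\frac1{\lambda_0}D_0^{-1}P_0D_0$, then $\tau(2)>-\delta$ and $m$ is multifractal. -/

import Mathlib

open Set Filter Topology MeasureTheory
open scoped ENNReal

noncomputable section

namespace MarkovMeasure

/-- A Markov chain `X 0, X 1, …` (the first variable has index `0`) on the state space `Fin ℓ`,
with initial distribution `p` and transition matrix `P`. The field `step` is the Markov property
with transition probabilities `P`, multiplied out so that no conditioning on a null event occurs. -/
structure IsMarkovChain {ℓ : ℕ} {Ω : Type*} [MeasurableSpace Ω] (μ : Measure Ω)
    (X : ℕ → Ω → Fin ℓ) (p : Fin ℓ → ℝ) (P : Matrix (Fin ℓ) (Fin ℓ) ℝ) : Prop where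
  measurable : ∀ n, Measurable (X n)
  stochastic : P ∈ Matrix.rowStochastic ℝ (Fin ℓ)
  init : ∀ i, μ.real {ω | X 0 ω = i} = p i
  step : ∀ (n : ℕ) (ε : Fin (n + 1) → Fin ℓ) (j : Fin ℓ),
    μ.real {ω | (∀ k : Fin (n + 1), X k ω = ε k) ∧ X (n + 1) ω = j} =
      μ.real {ω | ∀ k : Fin (n + 1), X k ω = ε k} * P (ε (Fin.last n)) j

/-- The half-open `ℓ`-adic interval of order `n` coded by the word `ε`: its left end point is
`∑ εᵢ / ℓ ^ i` (letters numbered from `1`) and its length is `1 / ℓ ^ n`. -/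
def adicInterval {ℓ n : ℕ} (ε : Fin n → Fin ℓ) : Set ℝ :=
  Ico (∑ i : Fin n, ((ε i : ℕ) : ℝ) / (ℓ : ℝ) ^ ((i : ℕ) + 1))
    ((∑ i : Fin n, ((ε i : ℕ) : ℝ) / (ℓ : ℝ) ^ ((i : ℕ) + 1)) + 1 / (ℓ : ℝ) ^ n)

/-- The Borel probability measure `m` on `ℝ` is driven by the process `X`: every `ℓ`-adic interval
has for mass the probability that the process starts with the word coding this interval. -/
structure IsDrivenBy {ℓ : ℕ} {Ω : Type*} [MeasurableSpace Ω] (m : Measure ℝ) (μ : Measure Ω)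
    (X : ℕ → Ω → Fin ℓ) : Prop where
  isProbabilityMeasure : IsProbabilityMeasure m
  adic : ∀ (n : ℕ) (ε : Fin n → Fin ℓ),
    m (adicInterval ε) = μ {ω | ∀ k : Fin n, X k ω = ε k}

/-- `p_{ε₁} p_{ε₁ε₂} ⋯ p_{ε_{n}ε_{n+1}}` for a word of length `n + 1`. -/
def wordWeight {ℓ n : ℕ} (p : Fin ℓ → ℝ) (P : Matrix (Fin ℓ) (Fin ℓ) ℝ)
    (ε : Fin (n + 1) → Fin ℓ) : ℝ :=
  p (ε 0) * ∏ k : Fin n, P (ε k.castSucc) (ε k.succ)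

/-- The Cantor-like set: the intersection over all `n ≥ 1` (here `n + 1`) of the union of the
closures of the `ℓ`-adic intervals of order `n` whose words are allowed by `p₀` and `P₀`. -/
def cantorSet {ℓ : ℕ} (p₀ : Fin ℓ → ℝ) (P₀ : Matrix (Fin ℓ) (Fin ℓ) ℝ) : Set ℝ :=
  ⋂ n : ℕ, ⋃ ε ∈ {ε : Fin (n + 1) → Fin ℓ | wordWeight p₀ P₀ ε = 1}, closure (adicInterval ε)

/-- The lower dimension of a measure. -/
def lowerDim (m : Measure ℝ) : ℝ≥0∞ :=
  ⨅ (E : Set ℝ) (_ : MeasurableSet E) (_ : 0 < m E), dimH E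

/-- The upper dimension of a probability measure. -/
def upperDim (m : Measure ℝ) : ℝ≥0∞ :=
  ⨅ (E : Set ℝ) (_ : MeasurableSet E) (_ : m E = 1), dimH E

/-- The measure `m` is unidimensional and its dimension is `d`. -/
def HasDim (m : Measure ℝ) (d : ℝ≥0∞) : Prop :=
  lowerDim m = d ∧ upperDim m = d

/-- The structure function `τ` of a measure, relative to the `ℓ`-adic intervals, with the
convention `0 ^ q = 0` for all real `q`. -/
def tau (ℓ : ℕ) (m : Measure ℝ) (q : ℝ) : EReal :=
  limsup (fun n : ℕ =>
    ((1 / ((n : ℝ) * Real.log ℓ) * Real.log (∑ ε : Fin n → Fin ℓ,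
      if m.real (adicInterval ε) = 0 then 0 else m.real (adicInterval ε) ^ q) : ℝ) : EReal)) atTop

/-- The set of points where the local dimension of `m` is the real number `α`. Outside the support
`log (m (B(x, r))) / log r` is `+∞` for small `r`, so that only points of the support count. -/
def levelSet (m : Measure ℝ) (α : ℝ) : Set ℝ :=
  {x | x ∈ m.support ∧
    Tendsto (fun r : ℝ => Real.log (m.real (Metric.ball x r)) / Real.log r) (𝓝[>] 0) (𝓝 α)}

/-- All points of the support have the same local dimension. -/
def IsMonofractal (m : Measure ℝ) : Prop :=
  ∃ α : ℝ, levelSet m α = m.support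

/-- At least two level sets are non-trivial, that is, of positive Hausdorff dimension. -/
def IsMultifractal (m : Measure ℝ) : Prop :=
  ∃ α β : ℝ, α ≠ β ∧ 0 < dimH (levelSet m α) ∧ 0 < dimH (levelSet m β)

/-- The spectral radius of a real matrix (maximal modulus of its complex eigenvalues). -/
def specRadius {ℓ : ℕ} (A : Matrix (Fin ℓ) (Fin ℓ) ℝ) : ℝ :=
  (spectralRadius ℂ (A.map (algebraMap ℝ ℂ))).toReal

/-- `π` is a probability vector with `A π = λ π`, where `λ` is the spectral radius of `A`. -/
def IsPerronVector {ℓ : ℕ} (A : Matrix (Fin ℓ) (Fin ℓ) ℝ) (π : Fin ℓ → ℝ) : Prop :=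
  π ∈ stdSimplex ℝ (Fin ℓ) ∧ A.mulVec π = specRadius A • π

/-- The matrix `λ⁻¹ D⁻¹ A D`, where `λ` is the spectral radius of `A` and `D` is the diagonal
matrix with diagonal `π`. -/
def normalized {ℓ : ℕ} (A : Matrix (Fin ℓ) (Fin ℓ) ℝ) (π : Fin ℓ → ℝ) :
    Matrix (Fin ℓ) (Fin ℓ) ℝ :=
  (specRadius A)⁻¹ • ((Matrix.diagonal π)⁻¹ * A * Matrix.diagonal π)

end MarkovMeasure

end

/-!
Let `c(P)` be the entropy of the chain, `t` the Perron eigenvalue of `P₀`, `v` its Perron vector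
and `N = normalized P₀ v`. The theorem is a comparison of `c(P)` with `log t`.

Stationary distributions are replaced by the Poisson equation `g = c + u - P u`: for an
irreducible stochastic `P` it has a solution `(c, u)` for each `g` (`exists_isPoissonSolution`),
and the maximum principle shows that the constant `c`, the mean of `g`, is strictly monotone in
`g`. Since `log N` is `- log t` plus a coboundary (`isPoissonSolution_log_normalized`), Gibbs'
inequality on each row gives `c(P) ≤ log t`, with equality only for `P = N` (`entropy_le_log`). In
the same way the cross entropy `c'` of `N` relative to `P` is at least `log t`
(`log_le_cross_entropy`).

Along the digits of a typical point of a Markov measure, the averages of a function of two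
consecutive digits converge to the constant of the Poisson equation
(`IsMarkovMeasure.ae_tendsto_average`), by a Chernoff bound for the sums corrected by the
coboundary and the Borel-Cantelli lemma. Hence the masses of the `ℓ`-adic intervals decay at a
known exponential rate. The same law bounds the runs of the digits `0` and `ℓ - 1`, so typical
points stay away from the end points of their intervals and intervals may be replaced by balls
(`IsMarkovMeasure.ae_localDim`): `m` has local dimension `c(P) / log ℓ` at its own typical points,
and `c' / log ℓ` at the typical points of a Markov measure `m₀` with transition matrix `N`. With
the mass distribution principle and a count of intervals, `m` has dimension `c(P) / log ℓ`, and
the Cantor set, which carries `m₀`, has dimension `log t / log ℓ`.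

If `P ≠ N`, then `c(P) < log t ≤ c'`, so `dim m` is less than the dimension of the Cantor set and
there are two nontrivial level sets; moreover `τ(2) ≥ - c(P) / log ℓ` by Jensen's inequality
(`IsMarkovMeasure.le_tau_two`). If `P = N`, the mass of each admissible interval of order `n` is
comparable with `t ^ (- n)`, so `m` is monofractal. That the positive entries of `P` are those of
`P₀` follows from the hypothesis on the support: as `P` has no entry `1`, the measures `m` and
`m₀` have no atoms, so they see the interiors of the intervals, and these determine the words.
-/

namespace MarkovMeasure

/-! ### The Perron eigenvector of an irreducible matrix -/

section Perron

variable {ι : Type*} [Fintype ι] {A : Matrix ι ι ℝ}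

/-- The form in which irreducibility is used throughout. -/
theorem _root_.Matrix.IsIrreducible.eq_univ_of_closed {ι : Type*} {A : Matrix ι ι ℝ}
    (hA : A.IsIrreducible) {S : Set ι} (hne : S.Nonempty)
    (hS : ∀ i ∈ S, ∀ j, 0 < A i j → j ∈ S) : S = univ := by
  obtain ⟨i, hi⟩ := hne
  refine eq_univ_of_forall fun j => ?_
  let _ : Quiver ι := A.toQuiver
  obtain ⟨q, -⟩ := hA.connected i j
  induction q with
  | nil => exact hi
  | cons q e ih => exact hS _ ih _ e.down

/-- A nonnegative eigenvector of an irreducible matrix vanishes nowhere: its zero set is closed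
under successors. -/
theorem pos_of_mulVec_eq_smul (hA : A.IsIrreducible) {t : ℝ} {v : ι → ℝ} (hv : 0 ≤ v)
    (hv0 : v ≠ 0) (h : A.mulVec v = t • v) (i : ι) : 0 < v i := by
  by_contra hi
  have hi0 : v i = 0 := le_antisymm (not_lt.1 hi) (hv i)
  have key := hA.eq_univ_of_closed (S := {i | v i = 0}) ⟨i, hi0⟩ ?_
  · exact hv0 (funext fun j => (key ▸ mem_univ j : j ∈ {i | v i = 0}))
  · intro a ha b hab
    have h1 : ∑ j, A a j * v j = 0 := by
      have := congrFun h a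
      simpa [Matrix.mulVec, dotProduct, show v a = 0 from ha] using this
    have h2 := (Finset.sum_eq_zero_iff_of_nonneg
      (fun j _ => mul_nonneg (hA.nonneg a j) (hv j))).1 h1 b (Finset.mem_univ b)
    exact (mul_eq_zero.1 h2).resolve_left hab.ne'

/-- If `s` is the smallest of the ratios `w i / v i`, then `w - s • v` is a nonnegative eigenvector
with a zero entry, hence it vanishes. -/
theorem eq_of_mulVec_eq_smul (hA : A.IsIrreducible) {t : ℝ} {v w : ι → ℝ}
    (hv : v ∈ stdSimplex ℝ ι) (hw : w ∈ stdSimplex ℝ ι)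
    (h : A.mulVec v = t • v) (h' : A.mulVec w = t • w) : w = v := by
  have hne : Nonempty ι := by
    by_contra hne
    rw [not_nonempty_iff] at hne
    simpa using hv.2
  have hv0 : v ≠ 0 := by
    rintro rfl
    simpa using hv.2
  have hvpos := pos_of_mulVec_eq_smul hA (fun i => hv.1 i) hv0 h
  obtain ⟨i, hi⟩ := Finite.exists_min (fun i => w i / v i)
  set s := w i / v i with hs
  have hz : w - s • v = 0 := by
    by_contra hz
    have h0 : 0 ≤ w - s • v := by
      intro j
      have := (le_div_iff₀ (hvpos j)).1 (hi j)
      simpa using this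
    have := pos_of_mulVec_eq_smul hA h0 hz (t := t)
      (by rw [Matrix.mulVec_sub, Matrix.mulVec_smul, h, h', smul_sub, smul_comm]) i
    have h1 : s * v i = w i := div_mul_cancel₀ _ (hvpos i).ne'
    simp [h1] at this
  have hws : w = s • v := sub_eq_zero.1 hz
  have hs1 : s = 1 := by
    have h1 := hw.2
    rw [hws] at h1
    simpa [← Finset.mul_sum, hv.2] using h1
  rw [hws, hs1, one_smul]

/-- The maximal `t` for which `t x ≤ A x` has a solution in the simplex is attained, by
compactness, and at a maximiser equality holds: otherwise multiplication by a positive polynomial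
in `A` would give a strict inequality in every coordinate, hence a larger `t`. -/
theorem exists_maximal_eigenvector [Nonempty ι] (hA : A.IsIrreducible) :
    ∃ (t : ℝ) (v : ι → ℝ), v ∈ stdSimplex ℝ ι ∧ A.mulVec v = t • v ∧
      ∀ (s : ℝ) (x : ι → ℝ), 0 ≤ x → x ≠ 0 → s • x ≤ A.mulVec x → s ≤ t := by
  classical
  set M : ℝ := ∑ i, ∑ j, A i j with hM
  have hM0 : 0 ≤ M := Finset.sum_nonneg fun i _ => Finset.sum_nonneg fun j _ => hA.nonneg i j
  have hMle : ∀ x ∈ stdSimplex ℝ ι, ∀ s : ℝ, s • x ≤ A.mulVec x → s ≤ M := by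
    intro x hx s h
    have h1 : ∑ i, (s • x) i ≤ ∑ i, A.mulVec x i := Finset.sum_le_sum fun i _ => h i
    have h2 : ∑ i, (s • x) i = s := by
      simp [← Finset.mul_sum, hx.2]
    rw [h2] at h1
    refine h1.trans (Finset.sum_le_sum fun i _ => Finset.sum_le_sum fun j _ => ?_)
    have : x j ≤ 1 := by
      rw [← hx.2]
      exact Finset.single_le_sum (fun k _ => hx.1 k) (Finset.mem_univ j)
    exact mul_le_of_le_one_right (hA.nonneg i j) this
  have hnorm : ∀ x : ι → ℝ, 0 ≤ x → x ≠ 0 → 0 < ∑ i, x i := by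
    intro x hx hx0
    obtain ⟨i, hi⟩ := Function.ne_iff.1 hx0
    exact Finset.sum_pos' (fun i _ => hx i)
      ⟨i, Finset.mem_univ i, lt_of_le_of_ne (hx i) (Ne.symm hi)⟩
  have hsimp : ∀ x : ι → ℝ, 0 ≤ x → x ≠ 0 → (∑ i, x i)⁻¹ • x ∈ stdSimplex ℝ ι := by
    intro x hx hx0
    have := hnorm x hx hx0
    refine ⟨fun i => mul_nonneg (inv_nonneg.2 this.le) (hx i), ?_⟩
    simp [← Finset.mul_sum, this.ne']
  have hscale : ∀ (s : ℝ) (x : ι → ℝ), 0 ≤ x → x ≠ 0 → s • x ≤ A.mulVec x →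
      s • ((∑ i, x i)⁻¹ • x) ≤ A.mulVec ((∑ i, x i)⁻¹ • x) := by
    intro s x hx hx0 h
    rw [Matrix.mulVec_smul, smul_comm]
    exact smul_le_smul_of_nonneg_left h (inv_nonneg.2 (hnorm x hx hx0).le)
  let K : Set ((ι → ℝ) × ℝ) := (stdSimplex ℝ ι ×ˢ Icc 0 M) ∩ {z | z.2 • z.1 ≤ A.mulVec z.1}
  have hK : IsCompact K := by
    refine ((isCompact_stdSimplex ℝ ι).prod isCompact_Icc).inter_right ?_
    refine isClosed_le (by fun_prop) ?_
    exact (Continuous.matrix_mulVec continuous_const continuous_fst)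
  have hKne : K.Nonempty := by
    obtain ⟨i⟩ := ‹Nonempty ι›
    refine ⟨(Pi.single i 1, 0), ⟨single_mem_stdSimplex ℝ i, by simp [hM0]⟩, ?_⟩
    intro j
    simp [hA.nonneg j i]
  obtain ⟨⟨v, t⟩, ⟨⟨hv, ht⟩, hvt⟩, hmax⟩ := hK.exists_isMaxOn hKne continuous_snd.continuousOn
  have hmax' : ∀ (s : ℝ) (x : ι → ℝ), 0 ≤ x → x ≠ 0 → s • x ≤ A.mulVec x → s ≤ t := by
    intro s x hx hx0 h
    rcases lt_or_ge s 0 with hs | hs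
    · exact hs.le.trans ht.1
    have h1 := hsimp x hx hx0
    have h2 := hscale s x hx hx0 h
    exact hmax (show ((∑ i, x i)⁻¹ • x, s) ∈ K from ⟨⟨h1, hs, hMle _ h1 _ h2⟩, h2⟩)
  refine ⟨t, v, hv, ?_, hmax'⟩
  by_contra hne
  choose k hk0 hk using (Matrix.isIrreducible_iff_exists_pow_pos hA.nonneg).1 hA
  have hpow : ∀ n i j, 0 ≤ (A ^ n) i j := fun n => by
    induction n with
    | zero => intro i j; by_cases h : i = j <;> simp [h]
    | succ n ih =>
      intro i j
      rw [pow_succ, Matrix.mul_apply]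
      exact Finset.sum_nonneg fun l _ => mul_nonneg (ih i l) (hA.nonneg l j)
  -- The matrix `B` has positive entries and commutes with `A`.
  let B : Matrix ι ι ℝ := ∑ i, ∑ j, A ^ k i j
  have hBapp : ∀ a b, B a b = ∑ i, ∑ j, (A ^ k i j) a b := by
    intro a b
    simp [B, Matrix.sum_apply]
  have hBpos : ∀ a b, 0 < B a b := by
    intro a b
    rw [hBapp]
    refine Finset.sum_pos' (fun i _ => Finset.sum_nonneg fun j _ => hpow _ _ _)
      ⟨a, Finset.mem_univ a, Finset.sum_pos' (fun j _ => hpow _ _ _) ⟨b, Finset.mem_univ b, hk a b⟩⟩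
  have hBA : B * A = A * B := by
    simp only [B, Finset.sum_mul, Finset.mul_sum, ← pow_succ, ← pow_succ']
  have hBvec : ∀ y : ι → ℝ, 0 ≤ y → y ≠ 0 → ∀ i, 0 < B.mulVec y i := by
    intro y hy hy0 i
    obtain ⟨j, hj⟩ := Function.ne_iff.1 hy0
    exact Finset.sum_pos' (fun l _ => mul_nonneg (hBpos i l).le (hy l))
      ⟨j, Finset.mem_univ j, mul_pos (hBpos i j) (lt_of_le_of_ne (hy j) (Ne.symm hj))⟩
  have hv0 : v ≠ 0 := by
    rintro rfl
    simpa using hv.2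
  have hy := hBvec (A.mulVec v - t • v) (sub_nonneg.2 hvt) (sub_ne_zero.2 hne)
  have hx := hBvec v (fun i => hv.1 i) hv0
  set x := B.mulVec v with hxdef
  have hy' : ∀ i, 0 < A.mulVec x i - t * x i := by
    intro i
    have := hy i
    rwa [Matrix.mulVec_sub, Matrix.mulVec_smul, Matrix.mulVec_mulVec, hBA, ← Matrix.mulVec_mulVec]
      at this
  obtain ⟨i, hi⟩ := Finite.exists_min (fun i => (A.mulVec x i - t * x i) / x i)
  have hpos := div_pos (hy' i) (hx i)
  have := hmax' (t + (A.mulVec x i - t * x i) / x i) x (fun j => (hx j).le)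
    (fun h0 => (hx i).ne' (congrFun h0 i)) (fun j => by
      have := (le_div_iff₀ (hx j)).1 (hi j)
      simp only [Pi.smul_apply, smul_eq_mul]
      linarith)
  linarith

/-- The maximal `t` bounds the modulus of every complex eigenvalue, since the moduli of the entries
of an eigenvector `w` for `z` satisfy `‖z‖ ‖w‖ ≤ A ‖w‖`. -/
theorem specRadius_eq {ℓ : ℕ} {A : Matrix (Fin ℓ) (Fin ℓ) ℝ} (hA : ∀ i j, 0 ≤ A i j) {t : ℝ}
    {v : Fin ℓ → ℝ} (hv : v ∈ stdSimplex ℝ (Fin ℓ)) (hvt : A.mulVec v = t • v)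
    (hmax : ∀ (s : ℝ) (x : Fin ℓ → ℝ), 0 ≤ x → x ≠ 0 → s • x ≤ A.mulVec x → s ≤ t) :
    specRadius A = t := by
  have hv0 : v ≠ 0 := by
    rintro rfl
    simpa using hv.2
  have ht : 0 ≤ t := by
    refine hmax 0 v (fun i => hv.1 i) hv0 fun i => ?_
    simpa [Matrix.mulVec, dotProduct] using
      Finset.sum_nonneg fun j _ => mul_nonneg (hA i j) (hv.1 j)
  set C : Matrix (Fin ℓ) (Fin ℓ) ℂ := A.map (algebraMap ℝ ℂ) with hC
  have hspec : ∀ z : ℂ, z ∈ spectrum ℂ C ↔ ∃ w : Fin ℓ → ℂ, w ≠ 0 ∧ C.mulVec w = z • w := by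
    intro z
    rw [← Matrix.spectrum_toLin', ← Module.End.hasEigenvalue_iff_mem_spectrum]
    constructor
    · intro h
      obtain ⟨w, hw⟩ := h.exists_hasEigenvector
      exact ⟨w, hw.2, by simpa using hw.apply_eq_smul⟩
    · rintro ⟨w, hw0, hw⟩
      exact Module.End.hasEigenvalue_of_hasEigenvector
        ⟨Module.End.mem_eigenspace_iff.2 (by simpa using hw), hw0⟩
  have hrad : spectralRadius ℂ C = ENNReal.ofReal t := by
    refine le_antisymm (iSup₂_le fun z hz => ?_) ?_
    · obtain ⟨w, hw0, hw⟩ := (hspec z).1 hz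
      have h1 : ‖z‖ ≤ t := by
        refine hmax ‖z‖ (fun i => ‖w i‖) (fun i => norm_nonneg _) ?_ fun i => ?_
        · intro h
          exact hw0 (funext fun i => norm_eq_zero.1 (congrFun h i))
        · have h2 := congrArg norm (congrFun hw i)
          simp only [Pi.smul_apply, smul_eq_mul, norm_mul] at h2 ⊢
          rw [← h2]
          simp only [Matrix.mulVec, dotProduct]
          refine (norm_sum_le _ _).trans (le_of_eq (Finset.sum_congr rfl fun j _ => ?_))
          simp [hC, abs_of_nonneg (hA i j)]
      calc ((‖z‖₊ : ENNReal)) = ENNReal.ofReal ‖z‖ := (ofReal_norm z).symm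
        _ ≤ ENNReal.ofReal t := ENNReal.ofReal_le_ofReal h1
    · have hmem : (t : ℂ) ∈ spectrum ℂ C := by
        refine (hspec _).2 ⟨fun i => (v i : ℂ), ?_, ?_⟩
        · intro h
          exact hv0 (funext fun i => by simpa using congrFun h i)
        · funext i
          have := congrArg (fun r : ℝ => (r : ℂ)) (congrFun hvt i)
          simpa [Matrix.mulVec, dotProduct, hC] using this
      refine le_trans (le_of_eq ?_) (le_iSup₂ (f := fun z _ => ((‖z‖₊ : ENNReal))) (t : ℂ) hmem)
      simp [ENNReal.ofReal, ← Real.toNNReal_eq_nnnorm_of_nonneg ht]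
  rw [specRadius, hrad, ENNReal.toReal_ofReal ht]

end Perron


/-! ### The Poisson equation of a stochastic matrix -/

section Poisson

variable {ι : Type*} [Fintype ι] {P : Matrix ι ι ℝ}

/-- The pair `(c, u)` solves the Poisson equation `g = c + u - P u`. For an irreducible stochastic
matrix `P` the constant `c` is the mean of `g` with respect to the stationary distribution. -/
def IsPoissonSolution (P : Matrix ι ι ℝ) (g : ι → ℝ) (c : ℝ) (u : ι → ℝ) : Prop :=
  ∀ i, g i = c + u i - P.mulVec u i

theorem IsPoissonSolution.neg {g : ι → ℝ} {c : ℝ} {u : ι → ℝ} (h : IsPoissonSolution P g c u) :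
    IsPoissonSolution P (-g) (-c) (-u) := by
  intro i
  simp only [Pi.neg_apply, h i, Matrix.mulVec_neg]
  ring

theorem IsPoissonSolution.add {g g' : ι → ℝ} {c c' : ℝ} {u u' : ι → ℝ}
    (h : IsPoissonSolution P g c u) (h' : IsPoissonSolution P g' c' u') :
    IsPoissonSolution P (g + g') (c + c') (u + u') := by
  intro i
  simp only [Pi.add_apply, h i, h' i, Matrix.mulVec_add]
  ring

theorem mulVec_le_of_forall_le (h0 : ∀ i j, 0 ≤ P i j) (h1 : ∀ i, ∑ j, P i j = 1) {u : ι → ℝ}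
    {b : ℝ} (hu : ∀ j, u j ≤ b) (i : ι) : P.mulVec u i ≤ b := by
  calc P.mulVec u i ≤ ∑ j, P i j * b :=
        Finset.sum_le_sum fun j _ => mul_le_mul_of_nonneg_left (hu j) (h0 i j)
    _ = b := by rw [← Finset.sum_mul, h1, one_mul]

/-- At a maximum of `u` the term `u - P u` is nonnegative. -/
theorem IsPoissonSolution.exists_le [Nonempty ι] (h0 : ∀ i j, 0 ≤ P i j)
    (h1 : ∀ i, ∑ j, P i j = 1) {g : ι → ℝ} {c : ℝ} {u : ι → ℝ}
    (h : IsPoissonSolution P g c u) : ∃ i, c ≤ g i := by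
  obtain ⟨i, hi⟩ := Finite.exists_max u
  have := mulVec_le_of_forall_le h0 h1 hi i
  exact ⟨i, by linarith [h i]⟩

theorem IsPoissonSolution.exists_ge [Nonempty ι] (h0 : ∀ i j, 0 ≤ P i j)
    (h1 : ∀ i, ∑ j, P i j = 1) {g : ι → ℝ} {c : ℝ} {u : ι → ℝ}
    (h : IsPoissonSolution P g c u) : ∃ i, g i ≤ c := by
  obtain ⟨i, hi⟩ := h.neg.exists_le h0 h1
  exact ⟨i, by simpa using hi⟩

/-- The maximum principle: the set where a subharmonic vector is maximal is closed under
successors. -/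
theorem eq_of_le_mulVec (hP : P.IsIrreducible) (h1 : ∀ i, ∑ j, P i j = 1) {u : ι → ℝ}
    (hu : ∀ i, u i ≤ P.mulVec u i) (i j : ι) : u i = u j := by
  have : Nonempty ι := ⟨i⟩
  obtain ⟨a, ha⟩ := Finite.exists_max u
  have key := hP.eq_univ_of_closed (S := {k | u k = u a}) ⟨a, rfl⟩ ?_
  · have hi : u i = u a := (key ▸ mem_univ i : i ∈ {k | u k = u a})
    have hj : u j = u a := (key ▸ mem_univ j : j ∈ {k | u k = u a})
    rw [hi, hj]
  · intro k hk l hkl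
    have hs : ∑ b, P k b * (u a - u b) = u a - P.mulVec u k := by
      simp only [mul_sub, Finset.sum_sub_distrib, ← Finset.sum_mul, h1, one_mul]
      rfl
    have hn : ∀ b ∈ Finset.univ, 0 ≤ P k b * (u a - u b) := fun b _ =>
      mul_nonneg (hP.nonneg k b) (sub_nonneg.2 (ha b))
    have h2 : ∑ b, P k b * (u a - u b) = 0 := by
      refine le_antisymm ?_ (Finset.sum_nonneg hn)
      have h3 : u k = u a := hk
      linarith [hu k]
    have h4 := (Finset.sum_eq_zero_iff_of_nonneg hn).1 h2 l (Finset.mem_univ l)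
    have h5 := (mul_eq_zero.1 h4).resolve_left hkl.ne'
    exact (sub_eq_zero.1 h5).symm

/-- Strict monotonicity of the mean: a nonpositive `g` of mean zero vanishes, because then `u` is
subharmonic. -/
theorem IsPoissonSolution.eq_zero_of_nonpos (hP : P.IsIrreducible) (h1 : ∀ i, ∑ j, P i j = 1)
    {g : ι → ℝ} {u : ι → ℝ} (h : IsPoissonSolution P g 0 u) (hg : ∀ i, g i ≤ 0) (i : ι) :
    g i = 0 := by
  have hc := eq_of_le_mulVec hP h1 (u := u) fun i => by linarith [h i, hg i]
  have h2 : P.mulVec u i = u i := by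
    calc P.mulVec u i = ∑ j, P i j * u i :=
          Finset.sum_congr rfl fun j _ => by rw [hc j i]
      _ = u i := by rw [← Finset.sum_mul, h1, one_mul]
  rw [h i, h2]
  ring

/-- The linear map `(c, u) ↦ c + u - P u` has kernel spanned by `(0, 1)`, by the maximum
principle, so a dimension count shows that it is onto. -/
theorem exists_isPoissonSolution (hP : P.IsIrreducible) (h1 : ∀ i, ∑ j, P i j = 1) (g : ι → ℝ) :
    ∃ c u, IsPoissonSolution P g c u := by
  rcases isEmpty_or_nonempty ι with hι | hι
  · exact ⟨0, 0, fun i => hι.elim i⟩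
  let T : (ℝ × (ι → ℝ)) →ₗ[ℝ] (ι → ℝ) :=
    { toFun := fun z i => z.1 + z.2 i - P.mulVec z.2 i
      map_add' := by
        intro x y
        funext i
        simp only [Prod.fst_add, Prod.snd_add, Pi.add_apply, Matrix.mulVec_add]
        ring
      map_smul' := by
        intro a x
        funext i
        simp only [Prod.smul_fst, Prod.smul_snd, Pi.smul_apply, Matrix.mulVec_smul, smul_eq_mul,
          RingHom.id_apply]
        ring }
  have hker : LinearMap.ker T ≤ Submodule.span ℝ {((0 : ℝ), (1 : ι → ℝ))} := by
    rintro ⟨c, u⟩ hz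
    have h : IsPoissonSolution P 0 c u := fun i => (congrFun (LinearMap.mem_ker.1 hz) i).symm
    obtain ⟨_, hle⟩ := h.exists_le hP.nonneg h1
    obtain ⟨_, hge⟩ := h.exists_ge hP.nonneg h1
    have hc : c = 0 := le_antisymm hle hge
    subst hc
    have hu := eq_of_le_mulVec hP h1 (u := u) fun i => by
      have : (0 : ℝ) = 0 + u i - P.mulVec u i := h i
      linarith
    obtain ⟨a⟩ := hι
    refine Submodule.mem_span_singleton.2 ⟨u a, ?_⟩
    ext i
    · simp
    · simp [hu i a]
  have hfin : Module.finrank ℝ (LinearMap.ker T) ≤ 1 :=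
    (Submodule.finrank_mono hker).trans (by
      simpa using finrank_span_le_card (R := ℝ) {((0 : ℝ), (1 : ι → ℝ))})
  have hrange : LinearMap.range T = ⊤ := by
    apply Submodule.eq_top_of_finrank_eq
    have hsum := LinearMap.finrank_range_add_finrank_ker T
    have hle := Submodule.finrank_le (LinearMap.range T)
    simp only [Module.finrank_prod, Module.finrank_self, Module.finrank_fintype_fun_eq_card]
      at hsum hle ⊢
    omega
  obtain ⟨⟨c, u⟩, hcu⟩ := LinearMap.range_eq_top.1 hrange g
  exact ⟨c, u, fun i => (congrFun hcu i).symm⟩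

end Poisson

/-! ### Entropy of Markov chains and the Perron eigenvalue -/

section Entropy

variable {ι : Type*} [Fintype ι]

/-- Each term of the relative entropy is controlled by `log x ≤ x - 1`. -/
theorem mul_log_sub_log_le {p q : ℝ} (hp : 0 ≤ p) (hq : 0 ≤ q) (hpq : 0 < p → 0 < q) :
    p * (Real.log q - Real.log p) ≤ q - p := by
  rcases hp.eq_or_lt with rfl | hp
  · simpa using hq
  · rw [← Real.log_div (hpq hp).ne' hp.ne']
    have := Real.log_le_sub_one_of_pos (div_pos (hpq hp) hp)
    calc p * Real.log (q / p) ≤ p * (q / p - 1) := mul_le_mul_of_nonneg_left this hp.le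
      _ = q - p := by field_simp

theorem sum_mul_log_sub_log_le {p q : ι → ℝ} (hp : ∀ i, 0 ≤ p i) (hq : ∀ i, 0 ≤ q i)
    (hpq : ∀ i, 0 < p i → 0 < q i) (hp1 : ∑ i, p i = 1) (hq1 : ∑ i, q i = 1) :
    ∑ i, p i * (Real.log (q i) - Real.log (p i)) ≤ 0 := by
  calc ∑ i, p i * (Real.log (q i) - Real.log (p i)) ≤ ∑ i, (q i - p i) :=
        Finset.sum_le_sum fun i _ => mul_log_sub_log_le (hp i) (hq i) (hpq i)
    _ = 0 := by rw [Finset.sum_sub_distrib, hp1, hq1, sub_self]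

theorem eq_of_sum_mul_log_sub_log_eq_zero {p q : ι → ℝ} (hp : ∀ i, 0 ≤ p i) (hq : ∀ i, 0 ≤ q i)
    (hpq : ∀ i, 0 < p i → 0 < q i) (hp1 : ∑ i, p i = 1) (hq1 : ∑ i, q i = 1)
    (h : ∑ i, p i * (Real.log (q i) - Real.log (p i)) = 0) (i : ι) : p i = q i := by
  have h0 : ∑ i, p i * (Real.log (q i) - Real.log (p i)) = ∑ i, (q i - p i) := by
    rw [h, Finset.sum_sub_distrib, hp1, hq1, sub_self]
  have h2 := (Finset.sum_eq_sum_iff_of_le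
    fun i _ => mul_log_sub_log_le (hp i) (hq i) (hpq i)).1 h0 i (Finset.mem_univ i)
  rcases (hp i).eq_or_lt with hi | hi
  · rw [← hi] at h2 ⊢
    simpa using h2
  · by_contra hne
    rw [← Real.log_div (hpq i hi).ne' hi.ne'] at h2
    have hne' : q i / p i ≠ 1 := fun h => hne ((div_eq_one_iff_eq hi.ne').1 h).symm
    have h3 := Real.log_lt_sub_one_of_pos (div_pos (hpq i hi) hi) hne'
    have h4 := mul_lt_mul_of_pos_left h3 hi
    have h5 : p i * (q i / p i - 1) = q i - p i := by field_simp
    linarith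

variable {A P R N : Matrix ι ι ℝ} {t : ℝ} {v : ι → ℝ}

/-- The logarithm of `A i j * v j / (t * v i)` is the constant `- log t` plus a coboundary, so its
mean is `- log t` for every transition matrix carried by the positive entries of `A`. -/
theorem isPoissonSolution_log_normalized (ht : 0 < t)
    (hv : ∀ i, 0 < v i) (hN : ∀ i j, N i j = A i j * v j / (t * v i))
    (hR1 : ∀ i, ∑ j, R i j = 1) (hRA : ∀ i j, R i j ≠ 0 → A i j = 1) :
    IsPoissonSolution R (fun i => ∑ j, R i j * Real.log (N i j)) (-Real.log t)
      (fun i => -Real.log (v i)) := by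
  intro i
  have h : ∀ j, R i j * Real.log (N i j) =
      R i j * (-Real.log t - Real.log (v i)) + R i j * Real.log (v j) := by
    intro j
    by_cases hj : R i j = 0
    · simp [hj]
    · rw [hN, hRA i j hj, one_mul, Real.log_div (hv j).ne' (mul_pos ht (hv i)).ne',
        Real.log_mul ht.ne' (hv i).ne']
      ring
  simp only [h, Finset.sum_add_distrib, ← Finset.sum_mul, hR1, Matrix.mulVec, dotProduct, mul_neg,
    Finset.sum_neg_distrib]
  ring

/-- The entropy of a Markov chain carried by the positive entries of `A` is at most `log t`, where
`t` is the Perron eigenvalue, with equality only for the normalized matrix. The value `log 0 = 0`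
agrees with the convention `0 log 0 = 0` for the entropy. -/
theorem entropy_le_log (hA : ∀ i j, A i j = 0 ∨ A i j = 1) (ht : 0 < t) (hv : ∀ i, 0 < v i)
    (hN : ∀ i j, N i j = A i j * v j / (t * v i)) (hN1 : ∀ i, ∑ j, N i j = 1) [Nonempty ι]
    (hP : P.IsIrreducible) (hP1 : ∀ i, ∑ j, P i j = 1) (hPA : ∀ i j, P i j ≠ 0 → A i j = 1)
    {c : ℝ} {u : ι → ℝ}
    (hc : IsPoissonSolution P (fun i => ∑ j, P i j * -Real.log (P i j)) c u) :
    c ≤ Real.log t ∧ (c = Real.log t → P = N) := by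
  have h := hc.add (isPoissonSolution_log_normalized ht hv hN hP1 hPA)
  have hN0 : ∀ i j, 0 ≤ N i j := by
    intro i j
    rw [hN]
    have hvi := hv i
    have hvj := hv j
    rcases hA i j with h | h <;> rw [h] <;> positivity
  have hPN : ∀ i j, 0 < P i j → 0 < N i j := by
    intro i j hij
    rw [hN, hPA i j hij.ne', one_mul]
    exact div_pos (hv j) (mul_pos ht (hv i))
  have heq : ∀ i, ((fun i => ∑ j, P i j * -Real.log (P i j)) +
      fun i => ∑ j, P i j * Real.log (N i j)) i =
      ∑ j, P i j * (Real.log (N i j) - Real.log (P i j)) := by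
    intro i
    simp only [Pi.add_apply, ← Finset.sum_add_distrib]
    exact Finset.sum_congr rfl fun j _ => by ring
  have hle : ∀ i, ((fun i => ∑ j, P i j * -Real.log (P i j)) +
      fun i => ∑ j, P i j * Real.log (N i j)) i ≤ 0 := by
    intro i
    rw [heq]
    exact sum_mul_log_sub_log_le (hP.nonneg i) (hN0 i) (hPN i) (hP1 i) (hN1 i)
  constructor
  · obtain ⟨i, hi⟩ := h.exists_le hP.nonneg hP1
    linarith [hle i]
  · rintro rfl
    rw [add_neg_cancel] at h
    ext i j
    have h0 := h.eq_zero_of_nonpos hP hP1 hle i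
    rw [heq] at h0
    exact eq_of_sum_mul_log_sub_log_eq_zero (hP.nonneg i) (hN0 i) (hPN i) (hP1 i) (hN1 i) h0 j

/-- The cross entropy exceeds the entropy `log t` of the normalized matrix by a mean relative
entropy. -/
theorem log_le_cross_entropy (hA : ∀ i j, A i j = 0 ∨ A i j = 1) (ht : 0 < t) (hv : ∀ i, 0 < v i)
    (hN : ∀ i j, N i j = A i j * v j / (t * v i)) (hN1 : ∀ i, ∑ j, N i j = 1) [Nonempty ι]
    (hP0 : ∀ i j, 0 ≤ P i j) (hP1 : ∀ i, ∑ j, P i j = 1) (hPA : ∀ i j, P i j ≠ 0 ↔ A i j = 1)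
    {c : ℝ} {u : ι → ℝ}
    (hc : IsPoissonSolution N (fun i => ∑ j, N i j * -Real.log (P i j)) c u) :
    Real.log t ≤ c := by
  have hN0 : ∀ i j, 0 ≤ N i j := by
    intro i j
    rw [hN]
    have hvi := hv i
    have hvj := hv j
    rcases hA i j with h | h <;> rw [h] <;> positivity
  have hNA : ∀ i j, N i j ≠ 0 → A i j = 1 := by
    intro i j hij
    refine (hA i j).resolve_left fun h => hij ?_
    rw [hN, h, zero_mul, zero_div]
  have h := hc.add (isPoissonSolution_log_normalized ht hv hN hN1 hNA)
  obtain ⟨i, hi⟩ := h.exists_ge hN0 hN1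
  have h2 := sum_mul_log_sub_log_le (hN0 i) (hP0 i)
    (fun j hj => lt_of_le_of_ne (hP0 i j) (Ne.symm ((hPA i j).2 (hNA i j hj.ne')))) (hN1 i) (hP1 i)
  have heq : ((fun i => ∑ j, N i j * -Real.log (P i j)) +
      fun i => ∑ j, N i j * Real.log (N i j)) i =
      -∑ j, N i j * (Real.log (P i j) - Real.log (N i j)) := by
    simp only [Pi.add_apply, ← Finset.sum_add_distrib, ← Finset.sum_neg_distrib]
    exact Finset.sum_congr rfl fun j _ => by ring
  rw [heq] at hi
  linarith

theorem entropy_pos [Nonempty ι] (hP0 : ∀ i j, 0 ≤ P i j) (hP1 : ∀ i, ∑ j, P i j = 1)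
    (hPne : ∀ i j, P i j ≠ 1) {c : ℝ} {u : ι → ℝ}
    (hc : IsPoissonSolution P (fun i => ∑ j, P i j * -Real.log (P i j)) c u) : 0 < c := by
  obtain ⟨i, hi⟩ := hc.exists_ge hP0 hP1
  refine lt_of_lt_of_le ?_ hi
  have hle : ∀ j, P i j ≤ 1 := fun j => by
    rw [← hP1 i]
    exact Finset.single_le_sum (fun k _ => hP0 i k) (Finset.mem_univ j)
  have hex : ∃ j, P i j ≠ 0 := by
    by_contra! h
    simpa [h] using hP1 i
  obtain ⟨j, hj⟩ := hex
  have hjpos := lt_of_le_of_ne (hP0 i j) (Ne.symm hj)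
  refine Finset.sum_pos' (fun k _ => mul_nonneg (hP0 i k)
    (neg_nonneg.2 (Real.log_nonpos (hP0 i k) (hle k)))) ⟨j, Finset.mem_univ j, ?_⟩
  exact mul_pos hjpos (neg_pos.2 (Real.log_neg hjpos (lt_of_le_of_ne (hle j) (hPne i j))))

end Entropy

/-! ### Sums over words -/

section Words

variable {ℓ : ℕ} {p : Fin ℓ → ℝ} {A : Matrix (Fin ℓ) (Fin ℓ) ℝ}

theorem wordWeight_snoc {n : ℕ} (w : Fin (n + 1) → Fin ℓ) (j : Fin ℓ) :
    wordWeight p A (Fin.snoc w j : Fin (n + 2) → Fin ℓ) =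
      wordWeight p A w * A (w (Fin.last n)) j := by
  have h0 : (Fin.snoc w j : Fin (n + 2) → Fin ℓ) 0 = w 0 := by
    rw [← Fin.castSucc_zero, Fin.snoc_castSucc (α := fun _ => Fin ℓ)]
  have h1 : ∀ k : Fin n, (Fin.snoc w j : Fin (n + 2) → Fin ℓ) k.castSucc.succ = w k.succ := by
    intro k
    rw [← Fin.castSucc_succ, Fin.snoc_castSucc (α := fun _ => Fin ℓ)]
  simp only [wordWeight, Fin.prod_univ_castSucc, h0, h1, Fin.snoc_castSucc (α := fun _ => Fin ℓ),
    Fin.succ_last, Fin.snoc_last, mul_assoc]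

theorem sum_wordWeight_succ (n : ℕ) (v : Fin ℓ → ℝ) :
    ∑ w : Fin (n + 2) → Fin ℓ, wordWeight p A w * v (w (Fin.last (n + 1))) =
      ∑ w : Fin (n + 1) → Fin ℓ, wordWeight p A w * A.mulVec v (w (Fin.last n)) := by
  rw [← (Fin.snocEquiv (fun _ : Fin (n + 2) => Fin ℓ)).sum_comp, Fintype.sum_prod_type_right]
  refine Finset.sum_congr rfl fun w _ => ?_
  have hs : ∀ j, Fin.snocEquiv (fun _ : Fin (n + 2) => Fin ℓ) (j, w) = Fin.snoc w j :=
    fun _ => rfl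
  simp only [hs, wordWeight_snoc, Fin.snoc_last, Matrix.mulVec, dotProduct, Finset.mul_sum,
    mul_assoc]

theorem sum_wordWeight_one (v : Fin ℓ → ℝ) :
    ∑ w : Fin 1 → Fin ℓ, wordWeight p A w * v (w (Fin.last 0)) = ∑ i, p i * v i := by
  rw [← (Equiv.funUnique (Fin 1) (Fin ℓ)).symm.sum_comp]
  simp [wordWeight]

theorem wordWeight_nonneg (hp : ∀ i, 0 ≤ p i) (hA : ∀ i j, 0 ≤ A i j) {n : ℕ}
    (w : Fin (n + 1) → Fin ℓ) : 0 ≤ wordWeight p A w :=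
  mul_nonneg (hp _) (Finset.prod_nonneg fun _ _ => hA _ _)

theorem sum_wordWeight_le (hp : ∀ i, 0 ≤ p i) (hA : ∀ i j, 0 ≤ A i j) {v : Fin ℓ → ℝ} {θ : ℝ}
    (hθ : 0 ≤ θ) (hv : ∀ i, A.mulVec v i ≤ θ * v i) (n : ℕ) :
    ∑ w : Fin (n + 1) → Fin ℓ, wordWeight p A w * v (w (Fin.last n)) ≤ θ ^ n * ∑ i, p i * v i := by
  induction n with
  | zero => rw [sum_wordWeight_one, pow_zero, one_mul]
  | succ n ih =>
    rw [sum_wordWeight_succ]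
    calc _ ≤ ∑ w : Fin (n + 1) → Fin ℓ, θ * (wordWeight p A w * v (w (Fin.last n))) := by
          refine Finset.sum_le_sum fun w _ => ?_
          have := mul_le_mul_of_nonneg_left (hv (w (Fin.last n))) (wordWeight_nonneg hp hA w)
          linarith
      _ ≤ _ := by
          rw [← Finset.mul_sum, pow_succ', mul_assoc]
          exact mul_le_mul_of_nonneg_left ih hθ

theorem le_sum_wordWeight (hp : ∀ i, 0 ≤ p i) (hA : ∀ i j, 0 ≤ A i j) {v : Fin ℓ → ℝ} {θ : ℝ}
    (hθ : 0 ≤ θ) (hv : ∀ i, θ * v i ≤ A.mulVec v i) (n : ℕ) :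
    θ ^ n * ∑ i, p i * v i ≤ ∑ w : Fin (n + 1) → Fin ℓ, wordWeight p A w * v (w (Fin.last n)) := by
  have h := sum_wordWeight_le hp hA (v := -v) hθ
    (fun i => by simpa [Matrix.mulVec_neg] using hv i) n
  simpa [Finset.sum_neg_distrib] using h

theorem sum_wordWeight_eq_one (hp : ∑ i, p i = 1) (hA : ∀ i, ∑ j, A i j = 1) (n : ℕ) :
    ∑ w : Fin (n + 1) → Fin ℓ, wordWeight p A w = 1 := by
  induction n with
  | zero => simpa [hp] using sum_wordWeight_one (p := p) (A := A) 1
  | succ n ih =>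
    have h := sum_wordWeight_succ (p := p) (A := A) n 1
    simpa [Matrix.mulVec, dotProduct, hA, ih] using h

end Words


/-! ### Intervals of the `ℓ`-adic filtration and digits -/

section Adic

variable {ℓ : ℕ}

/-- The left end point of the `ℓ`-adic interval of order `n` coded by the first `n` letters
of a sequence. -/
noncomputable def leftEnd (a : ℕ → Fin ℓ) (n : ℕ) : ℝ :=
  ∑ i ∈ Finset.range n, ((a i : ℕ) : ℝ) / (ℓ : ℝ) ^ (i + 1)

theorem adicInterval_seq (a : ℕ → Fin ℓ) (n : ℕ) :
    adicInterval (fun k : Fin n => a k) = Ico (leftEnd a n) (leftEnd a n + 1 / (ℓ : ℝ) ^ n) := by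
  rw [adicInterval, leftEnd,
    Fin.sum_univ_eq_sum_range (fun i => ((a i : ℕ) : ℝ) / (ℓ : ℝ) ^ (i + 1))]

theorem leftEnd_succ (a : ℕ → Fin ℓ) (n : ℕ) :
    leftEnd a (n + 1) = leftEnd a n + ((a n : ℕ) : ℝ) / (ℓ : ℝ) ^ (n + 1) :=
  Finset.sum_range_succ _ _

theorem leftEnd_mono (a : ℕ → Fin ℓ) : Monotone (leftEnd a) :=
  monotone_nat_of_le_succ fun n => by
    rw [leftEnd_succ]
    exact le_add_of_nonneg_right (by positivity)

theorem rightEnd_succ (a : ℕ → Fin ℓ) (n : ℕ) :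
    leftEnd a (n + 1) + 1 / (ℓ : ℝ) ^ (n + 1) =
      leftEnd a n + 1 / (ℓ : ℝ) ^ n - ((ℓ - 1 - (a n : ℕ) : ℝ)) / (ℓ : ℝ) ^ (n + 1) := by
  have hℓ : (ℓ : ℝ) ≠ 0 := by
    have := (a 0).pos
    positivity
  rw [leftEnd_succ]
  field_simp
  ring

theorem digit_le (i : Fin ℓ) : ((i : ℕ) : ℝ) ≤ ℓ - 1 := by
  have h : (i : ℕ) + 1 ≤ ℓ := i.2
  have : (((i : ℕ) + 1 : ℕ) : ℝ) ≤ ℓ := by exact_mod_cast h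
  push_cast at this
  linarith

theorem rightEnd_anti (a : ℕ → Fin ℓ) :
    Antitone fun n => leftEnd a n + 1 / (ℓ : ℝ) ^ n :=
  antitone_nat_of_succ_le fun n => by
    rw [rightEnd_succ]
    have : 0 ≤ ((ℓ - 1 - (a n : ℕ) : ℝ)) / (ℓ : ℝ) ^ (n + 1) :=
      div_nonneg (by linarith [digit_le (a n)]) (by positivity)
    linarith

theorem leftEnd_add_le {a : ℕ → Fin ℓ} {n k : ℕ} (h : ∃ i < k, (a (n + i) : ℕ) ≠ 0) :
    leftEnd a n + 1 / (ℓ : ℝ) ^ (n + k) ≤ leftEnd a (n + k) := by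
  obtain ⟨i, hik, hi⟩ := h
  have hℓ : (1 : ℝ) ≤ ℓ := by exact_mod_cast (a 0).pos
  have h1 : (1 : ℝ) ≤ ((a (n + i) : ℕ) : ℝ) := by exact_mod_cast Nat.one_le_iff_ne_zero.2 hi
  calc leftEnd a n + 1 / (ℓ : ℝ) ^ (n + k) ≤ leftEnd a (n + i) + 1 / (ℓ : ℝ) ^ (n + i + 1) :=
        add_le_add (leftEnd_mono a (by lia))
          (one_div_le_one_div_of_le (by positivity) (pow_le_pow_right₀ hℓ (by lia)))
    _ ≤ leftEnd a (n + i + 1) := by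
        rw [leftEnd_succ]
        gcongr
    _ ≤ leftEnd a (n + k) := leftEnd_mono a (by lia)

theorem rightEnd_add_le {a : ℕ → Fin ℓ} {n k : ℕ} (h : ∃ i < k, (a (n + i) : ℕ) ≠ ℓ - 1) :
    leftEnd a (n + k) + 1 / (ℓ : ℝ) ^ (n + k) ≤
      leftEnd a n + 1 / (ℓ : ℝ) ^ n - 1 / (ℓ : ℝ) ^ (n + k) := by
  obtain ⟨i, hik, hi⟩ := h
  have hℓ : (1 : ℝ) ≤ ℓ := by exact_mod_cast (a 0).pos
  have h1 : (1 : ℝ) ≤ ℓ - 1 - ((a (n + i) : ℕ) : ℝ) := by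
    have h2 : (a (n + i) : ℕ) + 2 ≤ ℓ := by have := (a (n + i)).2; lia
    have : (((a (n + i) : ℕ) + 2 : ℕ) : ℝ) ≤ ℓ := by exact_mod_cast h2
    push_cast at this
    linarith
  have h3 := rightEnd_anti a (show n + i + 1 ≤ n + k by lia)
  have h4 := rightEnd_anti a (show n ≤ n + i by lia)
  have h5 := rightEnd_succ a (n + i)
  have h6 : 1 / (ℓ : ℝ) ^ (n + k) ≤
      ((ℓ - 1 - (a (n + i) : ℕ) : ℝ)) / (ℓ : ℝ) ^ (n + i + 1) :=
    calc 1 / (ℓ : ℝ) ^ (n + k) ≤ 1 / (ℓ : ℝ) ^ (n + i + 1) :=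
          one_div_le_one_div_of_le (by positivity) (pow_le_pow_right₀ hℓ (by lia))
      _ ≤ _ := by gcongr
  simp only at h3 h4
  linarith

/-- If the block of digits of `x` at the places `n, …, n + k - 1` consists neither of zeros only
nor of digits `ℓ - 1` only, then `x` is not close to the boundary of its interval of order `n`. -/
theorem ball_subset_adicInterval {a : ℕ → Fin ℓ} {n k : ℕ} {x : ℝ}
    (hx : x ∈ adicInterval (fun i : Fin (n + k) => a i)) (h0 : ∃ i < k, (a (n + i) : ℕ) ≠ 0)
    (h1 : ∃ i < k, (a (n + i) : ℕ) ≠ ℓ - 1) :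
    Metric.ball x (1 / (ℓ : ℝ) ^ (n + k)) ⊆ adicInterval (fun i : Fin n => a i) := by
  rw [adicInterval_seq] at hx ⊢
  intro y hy
  rw [Metric.mem_ball, Real.dist_eq, abs_lt] at hy
  have h2 := leftEnd_add_le h0
  have h3 := rightEnd_add_le h1
  constructor <;> linarith [hx.1, hx.2]

theorem adicInterval_subset_ball {n : ℕ} {w : Fin n → Fin ℓ} {x r : ℝ} (hx : x ∈ adicInterval w)
    (hr : 1 / (ℓ : ℝ) ^ n ≤ r) : adicInterval w ⊆ Metric.ball x r := by
  intro y hy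
  rw [Metric.mem_ball, Real.dist_eq, abs_lt]
  rw [adicInterval] at hx hy
  constructor <;> linarith [hx.1, hx.2, hy.1, hy.2]

theorem measurableSet_adicInterval {n : ℕ} (w : Fin n → Fin ℓ) :
    MeasurableSet (adicInterval w) := measurableSet_Ico

theorem adicInterval_subset_init {n : ℕ} (w : Fin (n + 1) → Fin ℓ) :
    adicInterval w ⊆ adicInterval (fun k : Fin n => w k.castSucc) := by
  have h := digit_le (w (Fin.last n))
  have hℓ : (ℓ : ℝ) ≠ 0 := by
    have := (w 0).pos
    positivity
  intro x hx
  rw [adicInterval, Fin.sum_univ_castSucc] at hx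
  simp only [Fin.val_castSucc, Fin.val_last] at hx
  have h1 : 0 ≤ ((w (Fin.last n) : ℕ) : ℝ) / (ℓ : ℝ) ^ (n + 1) := by positivity
  have h2 : ((w (Fin.last n) : ℕ) : ℝ) / (ℓ : ℝ) ^ (n + 1) + 1 / (ℓ : ℝ) ^ (n + 1) ≤
      1 / (ℓ : ℝ) ^ n := by
    rw [← add_div, div_le_div_iff₀ (by positivity) (by positivity), pow_succ, one_mul,
      mul_comm ((ℓ : ℝ) ^ n)]
    gcongr
    linarith
  exact ⟨by linarith [hx.1], by simp only; linarith [hx.2]⟩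

theorem eq_of_mem_adicInterval {n : ℕ} {w w' : Fin n → Fin ℓ} {x : ℝ} (hx : x ∈ adicInterval w)
    (hx' : x ∈ adicInterval w') : w = w' := by
  induction n with
  | zero => exact Subsingleton.elim _ _
  | succ n ih =>
    have hi := ih (adicInterval_subset_init w hx) (adicInterval_subset_init w' hx')
    have hlast : w (Fin.last n) = w' (Fin.last n) := by
      have hℓ : (0 : ℝ) < ℓ := by exact_mod_cast (w 0).pos
      rw [adicInterval, Fin.sum_univ_castSucc] at hx hx'
      simp only [Fin.val_castSucc, Fin.val_last] at hx hx'
      have hs : ∑ i : Fin n, ((w i.castSucc : ℕ) : ℝ) / (ℓ : ℝ) ^ ((i : ℕ) + 1) =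
          ∑ i : Fin n, ((w' i.castSucc : ℕ) : ℝ) / (ℓ : ℝ) ^ ((i : ℕ) + 1) :=
        Finset.sum_congr rfl fun i _ => by rw [congrFun hi i]
      rw [hs] at hx
      have hp : 0 < (ℓ : ℝ) ^ (n + 1) := by positivity
      have h1 : ((w (Fin.last n) : ℕ) : ℝ) / (ℓ : ℝ) ^ (n + 1) <
          (((w' (Fin.last n) : ℕ) : ℝ) + 1) / (ℓ : ℝ) ^ (n + 1) := by
        rw [add_div]
        linarith [hx.1, hx'.2]
      have h2 : ((w' (Fin.last n) : ℕ) : ℝ) / (ℓ : ℝ) ^ (n + 1) <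
          (((w (Fin.last n) : ℕ) : ℝ) + 1) / (ℓ : ℝ) ^ (n + 1) := by
        rw [add_div]
        linarith [hx.2, hx'.1]
      rw [div_lt_div_iff_of_pos_right hp] at h1 h2
      have h3 : (w (Fin.last n) : ℕ) < (w' (Fin.last n) : ℕ) + 1 := by exact_mod_cast h1
      have h4 : (w' (Fin.last n) : ℕ) < (w (Fin.last n) : ℕ) + 1 := by exact_mod_cast h2
      exact Fin.ext (by lia)
    funext k
    induction k using Fin.lastCases with
    | last => exact hlast
    | cast k => exact congrFun hi k

theorem adicInterval_subset_Ico {n : ℕ} (w : Fin n → Fin ℓ) : adicInterval w ⊆ Ico 0 1 := by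
  induction n with
  | zero => simp [adicInterval]
  | succ n ih => exact (adicInterval_subset_init w).trans (ih _)

/-- The word of the first `n` digits of `x` in base `ℓ`. -/
noncomputable def adicWord (ℓ : ℕ) [NeZero ℓ] (n : ℕ) (x : ℝ) : Fin n → Fin ℓ :=
  fun k => Real.digits x ℓ k

theorem mem_adicInterval_adicWord [NeZero ℓ] {x : ℝ} (hx : x ∈ Ico (0 : ℝ) 1) (n : ℕ) :
    x ∈ adicInterval (adicWord ℓ n x) := by
  have hℓ : (0 : ℝ) < ℓ := by exact_mod_cast NeZero.pos ℓ
  have hs : leftEnd (Real.digits x ℓ) n =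
      ∑ i ∈ Finset.range n, Real.ofDigitsTerm (Real.digits x ℓ) i := by
    simp only [leftEnd, Real.ofDigitsTerm, div_eq_mul_inv]
  have h1 := Real.ofDigits_digits_sum_eq (b := ℓ) hx n
  have hp : 0 < (ℓ : ℝ) ^ n := by positivity
  have h2 : leftEnd (Real.digits x ℓ) n = ⌊(ℓ : ℝ) ^ n * x⌋₊ / (ℓ : ℝ) ^ n := by
    rw [hs, eq_div_iff hp.ne', mul_comm]
    exact h1
  unfold adicWord
  rw [adicInterval_seq, h2, ← add_div, mem_Ico, div_le_iff₀ hp, lt_div_iff₀ hp, mul_comm x]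
  exact ⟨Nat.floor_le (mul_nonneg hp.le hx.1), Nat.lt_floor_add_one _⟩

theorem closure_adicInterval {n : ℕ} (w : Fin (n + 1) → Fin ℓ) :
    closure (adicInterval w) =
      Icc (∑ i, ((w i : ℕ) : ℝ) / (ℓ : ℝ) ^ ((i : ℕ) + 1))
        ((∑ i, ((w i : ℕ) : ℝ) / (ℓ : ℝ) ^ ((i : ℕ) + 1)) + 1 / (ℓ : ℝ) ^ (n + 1)) := by
  have hℓ : 0 < (ℓ : ℝ) := by exact_mod_cast (w 0).pos
  have : 0 < 1 / (ℓ : ℝ) ^ (n + 1) := by positivity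
  exact closure_Ico (by linarith)

theorem interior_adicInterval {n : ℕ} (w : Fin n → Fin ℓ) :
    interior (adicInterval w) =
      Ioo (∑ i, ((w i : ℕ) : ℝ) / (ℓ : ℝ) ^ ((i : ℕ) + 1))
        ((∑ i, ((w i : ℕ) : ℝ) / (ℓ : ℝ) ^ ((i : ℕ) + 1)) + 1 / (ℓ : ℝ) ^ n) :=
  interior_Ico

theorem eq_of_mem_interior_of_mem_closure {n : ℕ} {w w' : Fin n → Fin ℓ} {x : ℝ}
    (hx : x ∈ interior (adicInterval w)) (hx' : x ∈ closure (adicInterval w')) : w = w' := by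
  obtain ⟨y, hy, hy'⟩ := mem_closure_iff.1 hx' _ isOpen_interior hx
  exact eq_of_mem_adicInterval (interior_subset hy) hy'

end Adic

/-! ### Markov measures on the line -/

section MarkovMeasure

variable {ℓ : ℕ}

/-- The Borel probability measure `m` gives to each `ℓ`-adic interval the weight of its word with
respect to the probability vector `p` and the stochastic matrix `P`. -/
structure IsMarkovMeasure (m : Measure ℝ) (p : Fin ℓ → ℝ) (P : Matrix (Fin ℓ) (Fin ℓ) ℝ) :
    Prop where
  isProbabilityMeasure : IsProbabilityMeasure m
  nonneg : ∀ i, 0 ≤ p i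
  sum_eq_one : ∑ i, p i = 1
  matrix_nonneg : ∀ i j, 0 ≤ P i j
  sum_row_eq_one : ∀ i, ∑ j, P i j = 1
  real_adicInterval : ∀ (n : ℕ) (w : Fin (n + 1) → Fin ℓ),
    m.real (adicInterval w) = wordWeight p P w

theorem IsMarkovChain.real_word {Ω : Type*} [MeasurableSpace Ω] {μ : Measure Ω}
    {X : ℕ → Ω → Fin ℓ} {p : Fin ℓ → ℝ} {P : Matrix (Fin ℓ) (Fin ℓ) ℝ} (hX : IsMarkovChain μ X p P)
    (n : ℕ) (w : Fin (n + 1) → Fin ℓ) :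
    μ.real {ω | ∀ k : Fin (n + 1), X k ω = w k} = wordWeight p P w := by
  induction n with
  | zero => simpa [wordWeight] using hX.init (w 0)
  | succ n ih =>
    have hset : {ω | ∀ k : Fin (n + 1 + 1), X k ω = w k} =
        {ω | (∀ k : Fin (n + 1), X k ω = w k.castSucc) ∧ X (n + 1) ω = w (Fin.last (n + 1))} := by
      ext ω
      simp [Fin.forall_fin_succ' (n := n + 1)]
    rw [hset, hX.step n (fun k => w k.castSucc), ih, ← wordWeight_snoc]
    congr 1
    funext k
    induction k using Fin.lastCases with
    | last => simp
    | cast k => simp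

theorem IsMarkovChain.isMarkovMeasure {Ω : Type*} [MeasurableSpace Ω] {μ : Measure Ω}
    [IsProbabilityMeasure μ] {X : ℕ → Ω → Fin ℓ} {p : Fin ℓ → ℝ} {P : Matrix (Fin ℓ) (Fin ℓ) ℝ}
    (hX : IsMarkovChain μ X p P) {m : Measure ℝ} (hm : IsDrivenBy m μ X) :
    IsMarkovMeasure m p P where
  isProbabilityMeasure := hm.isProbabilityMeasure
  nonneg i := by
    rw [← hX.init i]
    exact measureReal_nonneg
  sum_eq_one := by
    have h := sum_measureReal_preimage_singleton (μ := μ) (f := X 0) Finset.univ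
      (fun i _ => hX.measurable 0 (measurableSet_singleton i))
    calc ∑ i, p i = ∑ i, μ.real (X 0 ⁻¹' {i}) := by
          refine Finset.sum_congr rfl fun i _ => ?_
          rw [← hX.init i]
          rfl
      _ = 1 := by simp [h]
  matrix_nonneg i j := (Matrix.mem_rowStochastic_iff_sum.1 hX.stochastic).1 i j
  sum_row_eq_one i := (Matrix.mem_rowStochastic_iff_sum.1 hX.stochastic).2 i
  real_adicInterval n w := by
    rw [← hX.real_word, measureReal_def, hm.adic, measureReal_def]

variable {m : Measure ℝ} {p : Fin ℓ → ℝ} {P : Matrix (Fin ℓ) (Fin ℓ) ℝ}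

theorem wordWeight_le_pow (hp1 : ∀ i, p i ≤ 1) (hP : ∀ i j, 0 ≤ P i j)
    {c : ℝ} (hc : ∀ i j, P i j ≤ c) {n : ℕ} (w : Fin (n + 1) → Fin ℓ) :
    wordWeight p P w ≤ c ^ n := by
  calc wordWeight p P w ≤ 1 * ∏ _k : Fin n, c :=
        mul_le_mul (hp1 _) (Finset.prod_le_prod (fun _ _ => hP _ _) fun _ _ => hc _ _)
          (Finset.prod_nonneg fun _ _ => hP _ _) zero_le_one
    _ = c ^ n := by simp

theorem exists_bound_lt_one (h0 : ∀ i j, 0 ≤ P i j) (h1 : ∀ i, ∑ j, P i j = 1)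
    (hP1 : ∀ i j, P i j ≠ 1) : ∃ c : ℝ, 0 ≤ c ∧ c < 1 ∧ ∀ i j, P i j ≤ c := by
  rcases isEmpty_or_nonempty (Fin ℓ) with h | h
  · exact ⟨0, le_rfl, one_pos, fun i => h.elim i⟩
  · obtain ⟨a, ha⟩ := Finite.exists_max (fun z : Fin ℓ × Fin ℓ => P z.1 z.2)
    refine ⟨P a.1 a.2, h0 _ _, lt_of_le_of_ne ?_ (hP1 _ _), fun i j => ha (i, j)⟩
    rw [← h1 a.1]
    exact Finset.single_le_sum (fun k _ => h0 _ k) (Finset.mem_univ _)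

namespace IsMarkovMeasure

theorem ae_mem_Ico (hm : IsMarkovMeasure m p P) : ∀ᵐ x ∂m, x ∈ Ico (0 : ℝ) 1 := by
  have := hm.isProbabilityMeasure
  have h : m.real (⋃ w ∈ (Finset.univ : Finset (Fin 1 → Fin ℓ)), adicInterval w) = 1 := by
    rw [measureReal_biUnion_finset (fun w _ w' _ hww' => disjoint_left.2 fun x hx hx' =>
      hww' (eq_of_mem_adicInterval hx hx')) fun w _ => measurableSet_adicInterval w]
    rw [← sum_wordWeight_eq_one hm.sum_eq_one hm.sum_row_eq_one 0]
    exact Finset.sum_congr rfl fun w _ => hm.real_adicInterval 0 w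
  have h1 : m (⋃ w ∈ (Finset.univ : Finset (Fin 1 → Fin ℓ)), adicInterval w) = 1 := by
    rw [← ofReal_measureReal (measure_ne_top _ _), h, ENNReal.ofReal_one]
  refine (mem_ae_iff_prob_eq_one measurableSet_Ico).2 (le_antisymm prob_le_one ?_)
  rw [← h1]
  exact measure_mono (iUnion₂_subset fun w _ => adicInterval_subset_Ico w)

theorem measure_le_sum (hm : IsMarkovMeasure m p P) [NeZero ℓ] {n : ℕ}
    (S : Finset (Fin (n + 1) → Fin ℓ)) :
    m {x | x ∈ Ico (0 : ℝ) 1 ∧ adicWord ℓ (n + 1) x ∈ S} ≤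
      ENNReal.ofReal (∑ w ∈ S, wordWeight p P w) := by
  have := hm.isProbabilityMeasure
  calc m {x | x ∈ Ico (0 : ℝ) 1 ∧ adicWord ℓ (n + 1) x ∈ S} ≤ m (⋃ w ∈ S, adicInterval w) :=
        measure_mono fun x hx => mem_iUnion₂.2 ⟨_, hx.2, mem_adicInterval_adicWord hx.1 _⟩
    _ ≤ ∑ w ∈ S, m (adicInterval w) := measure_biUnion_finset_le _ _
    _ = ENNReal.ofReal (∑ w ∈ S, wordWeight p P w) := by
        rw [ENNReal.ofReal_sum_of_nonneg
          fun w _ => wordWeight_nonneg hm.nonneg hm.matrix_nonneg w]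
        refine Finset.sum_congr rfl fun w _ => ?_
        rw [← hm.real_adicInterval, ofReal_measureReal]

theorem le_one (hm : IsMarkovMeasure m p P) (i : Fin ℓ) : p i ≤ 1 := by
  rw [← hm.sum_eq_one]
  exact Finset.single_le_sum (fun k _ => hm.nonneg k) (Finset.mem_univ i)

theorem matrix_le_one (hm : IsMarkovMeasure m p P) (i j : Fin ℓ) : P i j ≤ 1 := by
  rw [← hm.sum_row_eq_one i]
  exact Finset.single_le_sum (fun k _ => hm.matrix_nonneg i k) (Finset.mem_univ j)

theorem measure_singleton (hm : IsMarkovMeasure m p P) (hP1 : ∀ i j, P i j ≠ 1) (x : ℝ) :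
    m {x} = 0 := by
  have := hm.isProbabilityMeasure
  have hne : NeZero ℓ := by
    refine ⟨?_⟩
    rintro rfl
    simpa using hm.sum_eq_one
  by_cases hx : x ∈ Ico (0 : ℝ) 1
  · obtain ⟨c, hc0, hc1, hc⟩ := exists_bound_lt_one hm.matrix_nonneg hm.sum_row_eq_one hP1
    have hle : ∀ n : ℕ, m.real {x} ≤ c ^ n := fun n => by
      calc m.real {x} ≤ m.real (adicInterval (adicWord ℓ (n + 1) x)) :=
            measureReal_mono (singleton_subset_iff.2 (mem_adicInterval_adicWord hx _))
        _ = wordWeight p P (adicWord ℓ (n + 1) x) := hm.real_adicInterval _ _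
        _ ≤ c ^ n := wordWeight_le_pow hm.le_one hm.matrix_nonneg hc _
    have h0 : m.real {x} ≤ 0 :=
      ge_of_tendsto' (tendsto_pow_atTop_nhds_zero_of_lt_one hc0 hc1) hle
    exact (measureReal_eq_zero_iff).1 (le_antisymm h0 measureReal_nonneg)
  · exact measure_mono_null (singleton_subset_iff.2 hx) hm.ae_mem_Ico

theorem measure_interior_adicInterval (hm : IsMarkovMeasure m p P) (hP1 : ∀ i j, P i j ≠ 1)
    {n : ℕ} (w : Fin n → Fin ℓ) : m (interior (adicInterval w)) = m (adicInterval w) := by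
  refine le_antisymm (measure_mono interior_subset) ?_
  rw [interior_adicInterval]
  calc m (adicInterval w) ≤ m ({∑ i, ((w i : ℕ) : ℝ) / (ℓ : ℝ) ^ ((i : ℕ) + 1)} ∪
        Ioo (∑ i, ((w i : ℕ) : ℝ) / (ℓ : ℝ) ^ ((i : ℕ) + 1))
        ((∑ i, ((w i : ℕ) : ℝ) / (ℓ : ℝ) ^ ((i : ℕ) + 1)) + 1 / (ℓ : ℝ) ^ n)) :=
        measure_mono fun x hx => hx.1.eq_or_lt.elim (fun h => Or.inl h.symm)
          fun h => Or.inr ⟨h, hx.2⟩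
    _ ≤ _ := (measure_union_le _ _).trans (by rw [hm.measure_singleton hP1, zero_add])

end IsMarkovMeasure

end MarkovMeasure


/-! ### The law of large numbers -/

section LawOfLargeNumbers

variable {ℓ : ℕ} {m : Measure ℝ} {p : Fin ℓ → ℝ} {P : Matrix (Fin ℓ) (Fin ℓ) ℝ}

/-- Tilting the transition matrix by `exp (s * D i j)` multiplies the weight of a word by the
exponential of `s` times the sum of `D` along the word. -/
theorem wordWeight_tilt (s : ℝ) (D : Fin ℓ → Fin ℓ → ℝ) {n : ℕ} (w : Fin (n + 1) → Fin ℓ) :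
    wordWeight p (Matrix.of fun i j => P i j * Real.exp (s * D i j)) w =
      wordWeight p P w * Real.exp (s * ∑ k : Fin n, D (w k.castSucc) (w k.succ)) := by
  simp only [wordWeight, Matrix.of_apply, Finset.prod_mul_distrib, Finset.mul_sum, Real.exp_sum,
    mul_assoc]

/-- The Chernoff bound. The row sums of the tilted matrix are at most `1 + (s * B) ^ 2`, because
`D` is centred. -/
theorem IsMarkovMeasure.sum_wordWeight_large_le (hm : IsMarkovMeasure m p P)
    {D : Fin ℓ → Fin ℓ → ℝ} (hD : ∀ i, ∑ j, P i j * D i j = 0) {B s ε : ℝ}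
    (hB : ∀ i j, |D i j| ≤ B) (hs : 0 ≤ s) (hsB : s * B ≤ 1) (n : ℕ) :
    ∑ w : Fin (n + 1) → Fin ℓ with n * ε ≤ ∑ k : Fin n, D (w k.castSucc) (w k.succ),
      wordWeight p P w ≤ Real.exp ((s * B) ^ 2 - s * ε) ^ n := by
  set Q : Matrix (Fin ℓ) (Fin ℓ) ℝ := Matrix.of fun i j => P i j * Real.exp (s * D i j) with hQ
  have hQ0 : ∀ i j, 0 ≤ Q i j := fun i j => mul_nonneg (hm.matrix_nonneg i j) (Real.exp_nonneg _)
  have hQ1 : ∀ i, Q.mulVec 1 i ≤ Real.exp ((s * B) ^ 2) * (1 : Fin ℓ → ℝ) i := by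
    intro i
    have hterm : ∀ j, Q i j ≤ P i j * (1 + (s * B) ^ 2) + s * (P i j * D i j) := by
      intro j
      have h1 : |s * D i j| ≤ s * B := by
        rw [abs_mul, abs_of_nonneg hs]
        exact mul_le_mul_of_nonneg_left (hB i j) hs
      have h2 := (abs_le.1 (Real.abs_exp_sub_one_sub_id_le (h1.trans hsB))).2
      have h3 : (s * D i j) ^ 2 ≤ (s * B) ^ 2 := sq_le_sq.2 (h1.trans (le_abs_self _))
      have h4 : Real.exp (s * D i j) ≤ 1 + (s * B) ^ 2 + s * D i j := by linarith
      calc Q i j ≤ P i j * (1 + (s * B) ^ 2 + s * D i j) :=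
            mul_le_mul_of_nonneg_left h4 (hm.matrix_nonneg i j)
        _ = _ := by ring
    calc Q.mulVec 1 i = ∑ j, Q i j := by simp [Matrix.mulVec, dotProduct]
      _ ≤ ∑ j, (P i j * (1 + (s * B) ^ 2) + s * (P i j * D i j)) :=
          Finset.sum_le_sum fun j _ => hterm j
      _ = (s * B) ^ 2 + 1 := by
          rw [Finset.sum_add_distrib, ← Finset.sum_mul, ← Finset.mul_sum, hD, hm.sum_row_eq_one]
          ring
      _ ≤ _ := by
          rw [Pi.one_apply, mul_one]
          exact Real.add_one_le_exp _
  have hsum := sum_wordWeight_le hm.nonneg hQ0 (Real.exp_nonneg _) hQ1 n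
  simp only [Pi.one_apply, mul_one, hm.sum_eq_one] at hsum
  calc _ ≤ ∑ w : Fin (n + 1) → Fin ℓ with n * ε ≤ ∑ k : Fin n, D (w k.castSucc) (w k.succ),
        Real.exp (-(s * ε)) ^ n * wordWeight p Q w := by
        refine Finset.sum_le_sum fun w hw => ?_
        have hw' := (Finset.mem_filter.1 hw).2
        rw [wordWeight_tilt, ← Real.exp_nat_mul, mul_left_comm, ← Real.exp_add]
        refine le_mul_of_one_le_right (wordWeight_nonneg hm.nonneg hm.matrix_nonneg w)
          (Real.one_le_exp ?_)
        have := mul_le_mul_of_nonneg_left hw' hs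
        linarith
    _ ≤ ∑ w : Fin (n + 1) → Fin ℓ, Real.exp (-(s * ε)) ^ n * wordWeight p Q w :=
        Finset.sum_le_sum_of_subset_of_nonneg (Finset.filter_subset _ _) fun w _ _ =>
          mul_nonneg (by positivity) (wordWeight_nonneg hm.nonneg hQ0 w)
    _ ≤ Real.exp (-(s * ε)) ^ n * Real.exp ((s * B) ^ 2) ^ n := by
        rw [← Finset.mul_sum]
        exact mul_le_mul_of_nonneg_left hsum (by positivity)
    _ = _ := by
        rw [← mul_pow, ← Real.exp_add]
        congr 2
        ring

theorem IsMarkovMeasure.neZero (hm : IsMarkovMeasure m p P) : NeZero ℓ := by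
  refine ⟨?_⟩
  rintro rfl
  simpa using hm.sum_eq_one

/-- The Chernoff bounds are summable in `n`, so the Borel-Cantelli lemma applies. -/
theorem IsMarkovMeasure.ae_eventually_sum_lt (hm : IsMarkovMeasure m p P) [NeZero ℓ]
    {D : Fin ℓ → Fin ℓ → ℝ} (hD : ∀ i, ∑ j, P i j * D i j = 0) {ε : ℝ} (hε : 0 < ε) :
    ∀ᵐ x ∂m, ∀ᶠ n : ℕ in atTop,
      ∑ k ∈ Finset.range n, D (Real.digits x ℓ k) (Real.digits x ℓ (k + 1)) < n * ε := by
  obtain ⟨B, hB1, hB⟩ : ∃ B : ℝ, 1 ≤ B ∧ ∀ i j, |D i j| ≤ B := by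
    obtain ⟨a, ha⟩ := Finite.exists_max (fun z : Fin ℓ × Fin ℓ => |D z.1 z.2|)
    exact ⟨max 1 |D a.1 a.2|, le_max_left _ _, fun i j => (ha (i, j)).trans (le_max_right _ _)⟩
  have hB0 : 0 < B := by linarith
  -- The exponent `(s * B) ^ 2 - s * ε` is negative for small `s`.
  set s := min (1 / B) (ε / (2 * B ^ 2)) with hs
  have hs0 : 0 < s := lt_min (by positivity) (by positivity)
  have hsB : s * B ≤ 1 := (le_div_iff₀ hB0).1 (min_le_left _ _)
  have hsB2 : s * (2 * B ^ 2) ≤ ε := (le_div_iff₀ (by positivity)).1 (min_le_right _ _)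
  have hr : (s * B) ^ 2 - s * ε < 0 := by
    have h1 := mul_le_mul_of_nonneg_left hsB2 hs0.le
    have h2 : 0 < (s * B) ^ 2 := by positivity
    nlinarith
  set r := Real.exp ((s * B) ^ 2 - s * ε)
  have hr1 : r < 1 := Real.exp_lt_one_iff.2 hr
  have hr0 : 0 ≤ r := Real.exp_nonneg _
  let S : ℕ → Set ℝ := fun n => {x | x ∈ Ico (0 : ℝ) 1 ∧
    n * ε ≤ ∑ k ∈ Finset.range n, D (Real.digits x ℓ k) (Real.digits x ℓ (k + 1))}
  have hS : ∀ n, m (S n) ≤ ENNReal.ofReal (r ^ n) := by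
    intro n
    refine le_trans (measure_mono fun x hx => ?_) ((hm.measure_le_sum _).trans
      (ENNReal.ofReal_le_ofReal (hm.sum_wordWeight_large_le hD hB hs0.le hsB n)))
    refine ⟨hx.1, Finset.mem_filter.2 ⟨Finset.mem_univ _, ?_⟩⟩
    have h2 := hx.2
    rw [Finset.sum_range] at h2
    exact h2
  have hfin : ∑' n, m (S n) ≠ ∞ := by
    refine ne_top_of_le_ne_top ?_ (ENNReal.tsum_le_tsum hS)
    rw [← ENNReal.ofReal_tsum_of_nonneg (fun n => pow_nonneg hr0 n)
      (summable_geometric_of_lt_one hr0 hr1)]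
    exact ENNReal.ofReal_ne_top
  filter_upwards [ae_eventually_notMem hfin, hm.ae_mem_Ico] with x hx hxI
  filter_upwards [hx] with n hn
  by_contra h
  exact hn ⟨hxI, not_lt.1 h⟩

/-- The law of large numbers: along the digits of almost every point, the averages of `f` converge
to the constant of the Poisson equation. The corrected sums are martingales with bounded
increments. -/
theorem IsMarkovMeasure.ae_tendsto_average (hm : IsMarkovMeasure m p P) [NeZero ℓ]
    {f : Fin ℓ → Fin ℓ → ℝ} {c : ℝ} {u : Fin ℓ → ℝ}
    (hc : IsPoissonSolution P (fun i => ∑ j, P i j * f i j) c u) :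
    ∀ᵐ x ∂m, Tendsto (fun n : ℕ =>
      (∑ k ∈ Finset.range n, f (Real.digits x ℓ k) (Real.digits x ℓ (k + 1))) / n)
      atTop (𝓝 c) := by
  -- The Poisson equation says that `D` has mean zero with respect to each row of `P`.
  let D : Fin ℓ → Fin ℓ → ℝ := fun i j => f i j - c - u i + u j
  have hD : ∀ i, ∑ j, P i j * D i j = 0 := by
    intro i
    have h := hc i
    have h1 : ∀ j, P i j * D i j = P i j * f i j + P i j * (-c - u i) + P i j * u j := fun j => by
      simp only [D]; ring
    simp only [h1, Finset.sum_add_distrib, ← Finset.sum_mul, hm.sum_row_eq_one]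
    simp only [Matrix.mulVec, dotProduct] at h
    linarith
  have hD' : ∀ i, ∑ j, P i j * -D i j = 0 := by
    intro i
    simp [hD i]
  obtain ⟨U, hU⟩ := Finite.exists_max (fun i => |u i|)
  have hall : ∀ᵐ x ∂m, ∀ a : ℕ, ∀ᶠ n : ℕ in atTop,
      ∑ k ∈ Finset.range n, D (Real.digits x ℓ k) (Real.digits x ℓ (k + 1)) <
        n * (1 / ((a : ℝ) + 1)) ∧
      ∑ k ∈ Finset.range n, -D (Real.digits x ℓ k) (Real.digits x ℓ (k + 1)) <
        n * (1 / ((a : ℝ) + 1)) := by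
    rw [ae_all_iff]
    intro a
    filter_upwards [hm.ae_eventually_sum_lt hD (Nat.one_div_pos_of_nat (n := a) (α := ℝ)),
      hm.ae_eventually_sum_lt (D := fun i j => -D i j) hD'
        (Nat.one_div_pos_of_nat (n := a) (α := ℝ))] with x h1 h2 using h1.and h2
  filter_upwards [hall] with x hx
  set d := Real.digits x ℓ
  have hsum : ∀ n, ∑ k ∈ Finset.range n, D (d k) (d (k + 1)) =
      ∑ k ∈ Finset.range n, f (d k) (d (k + 1)) - n * c + (u (d n) - u (d 0)) := by
    intro n
    rw [← Finset.sum_range_sub (fun k => u (d k)) n]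
    simp only [D, Finset.sum_add_distrib, Finset.sum_sub_distrib, Finset.sum_const,
      Finset.card_range, nsmul_eq_mul]
    ring
  have h1 : Tendsto (fun n : ℕ => (∑ k ∈ Finset.range n, D (d k) (d (k + 1))) / n) atTop
      (𝓝 0) := by
    rw [Metric.tendsto_atTop']
    intro ε hε
    obtain ⟨a, ha⟩ := exists_nat_one_div_lt hε
    obtain ⟨N, hN⟩ := eventually_atTop.1 (hx a)
    refine ⟨N, fun n hn => ?_⟩
    have hn0 : (0 : ℝ) < n := by exact_mod_cast (Nat.zero_le N).trans_lt hn
    obtain ⟨h2, h3⟩ := hN n hn.le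
    rw [Finset.sum_neg_distrib] at h3
    rw [Real.dist_eq, sub_zero, abs_div, abs_of_pos hn0, div_lt_iff₀ hn0]
    have h4 : (n : ℝ) * (1 / ((a : ℝ) + 1)) < ε * n := by
      rw [mul_comm]
      exact mul_lt_mul_of_pos_right ha hn0
    exact abs_lt.2 ⟨by linarith, by linarith⟩
  have h2 : Tendsto (fun n : ℕ => (u (d n) - u (d 0)) / (n : ℝ)) atTop (𝓝 0) := by
    refine squeeze_zero_norm (a := fun n : ℕ => (2 * |u U|) / (n : ℝ)) (fun n => ?_)
      (tendsto_const_div_atTop_nhds_zero_nat _)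
    rw [norm_div, Real.norm_natCast, Real.norm_eq_abs]
    gcongr
    calc |u (d n) - u (d 0)| ≤ |u (d n)| + |u (d 0)| := abs_sub _ _
      _ ≤ 2 * |u U| := by linarith [hU (d n), hU (d 0)]
  have h3 := (h1.sub h2).add_const c
  simp only [sub_zero, zero_add] at h3
  refine h3.congr' ?_
  filter_upwards [eventually_gt_atTop 0] with n hn
  have hn0 : (n : ℝ) ≠ 0 := by exact_mod_cast hn.ne'
  rw [hsum]
  field_simp
  ring

end LawOfLargeNumbers


/-! ### Local dimensions at typical points -/

section LocalDimension

variable {ℓ : ℕ} {m : Measure ℝ} {p : Fin ℓ → ℝ} {P : Matrix (Fin ℓ) (Fin ℓ) ℝ}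

/-- Runs of a fixed digit `a` starting at the place `n` have length `o(n)`: otherwise the frequency
of the block `aa`, which has a limit less than one, would increase along the run. -/
theorem IsMarkovMeasure.ae_eventually_exists_digit_ne (hm : IsMarkovMeasure m p P) [NeZero ℓ]
    (hP : P.IsIrreducible) (hP1 : ∀ i j, P i j ≠ 1) (a : Fin ℓ) :
    ∀ᵐ x ∂m, ∀ ε : ℝ, 0 < ε → ∀ᶠ n : ℕ in atTop,
      ∃ i < ⌈ε * n⌉₊ + 1, Real.digits x ℓ (n + i) ≠ a := by
  classical
  let f : Fin ℓ → Fin ℓ → ℝ := fun i j => if i = a ∧ j = a then 1 else 0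
  obtain ⟨c, u, hc⟩ := exists_isPoissonSolution hP hm.sum_row_eq_one (fun i => ∑ j, P i j * f i j)
  have hc1 : c < 1 := by
    obtain ⟨i, hi⟩ := hc.exists_le hm.matrix_nonneg hm.sum_row_eq_one
    refine hi.trans_lt ?_
    by_cases hia : i = a
    · have : ∑ j, P i j * f i j = P i a := by simp [f, hia]
      rw [this]
      exact lt_of_le_of_ne (hm.matrix_le_one _ _) (hP1 _ _)
    · simp [f, hia]
  filter_upwards [hm.ae_tendsto_average hc] with x hx ε hε
  set d := Real.digits x ℓ
  let N : ℕ → ℝ := fun n => ∑ k ∈ Finset.range n, f (d k) (d (k + 1))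
  -- A run of length `T ≥ ε n` raises the count by `T`, while it may rise by at most
  -- `c T + η (2 n + T)`; this value of `η` makes the two incompatible.
  set η := ε * (1 - c) / (2 * (2 + ε)) with hη
  have hη0 : 0 < η := by
    have : 0 < 1 - c := by linarith
    positivity
  obtain ⟨n₀, hn₀⟩ := (Metric.tendsto_atTop.1 hx) η hη0
  have hN : ∀ n : ℕ, n₀ ≤ n → 0 < n → |N n - c * n| ≤ η * n := by
    intro n hn hn0
    have hn0' : (0 : ℝ) < n := by exact_mod_cast hn0
    have h := (hn₀ n hn).le
    rw [Real.dist_eq] at h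
    have h2 : N n - c * n = (N n / n - c) * n := by field_simp
    rw [h2, abs_mul, abs_of_pos hn0']
    exact mul_le_mul_of_nonneg_right h hn0'.le
  filter_upwards [eventually_ge_atTop n₀, eventually_gt_atTop 0] with n hn hn0
  by_contra! hrun
  set T := ⌈ε * n⌉₊
  have hn0' : (0 : ℝ) < n := by exact_mod_cast hn0
  have hT : ε * n ≤ T := Nat.le_ceil _
  have hNT : N (n + T) = N n + T := by
    simp only [N, Finset.sum_range_add]
    congr 1
    calc ∑ k ∈ Finset.range T, f (d (n + k)) (d (n + k + 1)) = ∑ k ∈ Finset.range T, (1 : ℝ) := by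
          refine Finset.sum_congr rfl fun k hk => ?_
          have hk' := Finset.mem_range.1 hk
          have h1 := hrun k (by lia)
          have h2 := hrun (k + 1) (by lia)
          rw [← add_assoc] at h2
          simp [f, h1, h2]
      _ = T := by simp
  have h1 := (abs_le.1 (hN n hn hn0)).1
  have h2 := (abs_le.1 (hN (n + T) (by lia) (by lia))).2
  rw [hNT] at h2
  push_cast at h2
  have h3 : η * (2 * (2 + ε)) = ε * (1 - c) := by
    rw [hη]
    field_simp
  have h5 : η ≤ (1 - c) / 2 := by
    rw [hη, div_le_div_iff₀ (by positivity) two_pos]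
    nlinarith
  have h6 : (1 - c - η) * T ≤ 2 * η * n := by linarith
  have h7 := mul_le_mul_of_nonneg_left hT (show 0 ≤ 1 - c - η by linarith)
  have h8 : (1 - c - η) * ε * n ≤ 2 * η * n := by linarith
  have h9 := le_of_mul_le_mul_right h8 hn0'
  nlinarith

/-- A monotone function is asymptotic to `L t` if it is squeezed between `b n` and `a n`, up to a
change of the argument from `n` to `(1 + ε) n + 1`. -/
theorem tendsto_div_of_squeeze {ψ : ℝ → ℝ} (hψ : Monotone ψ) {a b : ℕ → ℝ} {L : ℝ}
    (ha : Tendsto (fun n : ℕ => a n / n) atTop (𝓝 L))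
    (hb : Tendsto (fun n : ℕ => b n / n) atTop (𝓝 L)) (h1 : ∀ n : ℕ, ψ n ≤ a n)
    (h2 : ∀ ε : ℝ, 0 < ε → ∀ᶠ n : ℕ in atTop, b n ≤ ψ (n + (⌈ε * n⌉₊ + 1) : ℕ)) :
    Tendsto (fun t => ψ t / t) atTop (𝓝 L) := by
  have hcomp : ∀ (a : ℕ → ℝ) (N : ℝ → ℕ) (y : ℝ), Tendsto (fun n : ℕ => a n / n) atTop (𝓝 L) →
      Tendsto N atTop atTop → Tendsto (fun t : ℝ => (N t : ℝ) / t) atTop (𝓝 y) →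
      Tendsto (fun t => a (N t) / t) atTop (𝓝 (L * y)) := by
    intro a N y ha hN hy
    refine ((ha.comp hN).mul hy).congr' ?_
    filter_upwards [hN.eventually (eventually_gt_atTop 0)] with t ht
    have : (N t : ℝ) ≠ 0 := by exact_mod_cast ht.ne'
    simp only [Function.comp]
    field_simp
  -- From above, `t` is compared with `⌈t⌉`; from below, with `⌊t / (1 + 2 ε)⌋`.
  have hup : Tendsto (fun t : ℝ => a ⌈t⌉₊ / t) atTop (𝓝 L) := by
    simpa using hcomp a (fun t => ⌈t⌉₊) 1 ha tendsto_nat_ceil_atTop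
      (tendsto_nat_ceil_div_atTop (R := ℝ))
  rw [tendsto_order]
  refine ⟨fun L' hL' => ?_, fun L' hL' => ?_⟩
  · have hcont : Tendsto (fun ε : ℝ => L * (1 / (1 + 2 * ε))) (𝓝[>] 0) (𝓝 L) := by
      have : ContinuousAt (fun ε : ℝ => L * (1 / (1 + 2 * ε))) 0 := by
        have : (1 + 2 * (0 : ℝ)) ≠ 0 := by norm_num
        fun_prop (disch := assumption)
      simpa using this.tendsto.mono_left nhdsWithin_le_nhds
    obtain ⟨ε, hεL, hε⟩ := ((hcont.eventually (lt_mem_nhds hL')).and self_mem_nhdsWithin).exists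
    have hε0 : 0 < ε := hε
    set y := 1 / (1 + 2 * ε) with hy
    have hy0 : 0 < y := by positivity
    have hN : Tendsto (fun t : ℝ => ⌊y * t⌋₊) atTop atTop :=
      tendsto_nat_floor_atTop.comp (tendsto_id.const_mul_atTop hy0)
    have hlow := hcomp b (fun t => ⌊y * t⌋₊) y hb hN (tendsto_nat_floor_mul_div_atTop hy0.le)
    filter_upwards [hlow.eventually (lt_mem_nhds hεL), hN.eventually (h2 ε hε0),
      eventually_gt_atTop 0, eventually_ge_atTop (2 * (1 + 2 * ε) / ε)] with t ht1 ht2 ht0 ht3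
    refine ht1.trans_le (div_le_div_of_nonneg_right (ht2.trans (hψ ?_)) ht0.le)
    have h3 : (⌊y * t⌋₊ : ℝ) ≤ y * t := Nat.floor_le (by positivity)
    have h4 := (Nat.ceil_lt_add_one (show 0 ≤ ε * (⌊y * t⌋₊ : ℝ) by positivity)).le
    have h5 : ε * (⌊y * t⌋₊ : ℝ) ≤ ε * (y * t) := mul_le_mul_of_nonneg_left h3 hε0.le
    have h6 : 2 * (1 + 2 * ε) ≤ t * ε := (div_le_iff₀ hε0).1 ht3
    have h7 : y * t * (1 + 2 * ε) = t := by
      rw [hy]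
      field_simp
    have h8 : 2 ≤ y * t * ε := by
      have h9 : y * (2 * (1 + 2 * ε)) = 2 := by
        rw [hy]
        field_simp
      have h10 := mul_le_mul_of_nonneg_left h6 hy0.le
      linarith
    push_cast
    linarith
  · filter_upwards [hup.eventually (gt_mem_nhds hL'), eventually_gt_atTop 0] with t ht ht0
    exact (div_le_div_of_nonneg_right ((hψ (Nat.le_ceil t)).trans (h1 _)) ht0.le).trans_lt ht

/-- The local dimension is determined by a lower bound `exp (- a n)` for the masses of the balls of
radius `ℓ ^ (- n)` and an upper bound `exp (- b n)` for slightly smaller balls, provided that `a`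
and `b` have the same linear growth. -/
theorem tendsto_log_ball_div_log [IsFiniteMeasure m] (hℓ : 1 < ℓ) {x L : ℝ} {a b : ℕ → ℝ}
    (ha : Tendsto (fun n : ℕ => a n / n) atTop (𝓝 L))
    (hb : Tendsto (fun n : ℕ => b n / n) atTop (𝓝 L))
    (hpos : ∀ r, 0 < r → 0 < m.real (Metric.ball x r))
    (h1 : ∀ n : ℕ, -Real.log (m.real (Metric.ball x (1 / (ℓ : ℝ) ^ n))) ≤ a n)
    (h2 : ∀ ε : ℝ, 0 < ε → ∀ᶠ n : ℕ in atTop,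
      b n ≤ -Real.log (m.real (Metric.ball x (1 / (ℓ : ℝ) ^ (n + (⌈ε * n⌉₊ + 1)))))) :
    Tendsto (fun r : ℝ => Real.log (m.real (Metric.ball x r)) / Real.log r) (𝓝[>] 0)
      (𝓝 (L / Real.log ℓ)) := by
  have hℓ1 : (1 : ℝ) < ℓ := by exact_mod_cast hℓ
  have hℓ0 : (0 : ℝ) < ℓ := by linarith
  have hlog : 0 < Real.log ℓ := Real.log_pos hℓ1
  let ψ : ℝ → ℝ := fun t => -Real.log (m.real (Metric.ball x ((ℓ : ℝ) ^ (-t))))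
  have hpow : ∀ n : ℕ, 1 / (ℓ : ℝ) ^ n = (ℓ : ℝ) ^ (-(n : ℝ)) := fun n => by
    rw [Real.rpow_neg hℓ0.le, Real.rpow_natCast, one_div]
  have hmono : Monotone ψ := fun s t hst => by
    refine neg_le_neg (Real.log_le_log (hpos _ (Real.rpow_pos_of_pos hℓ0 _))
      (measureReal_mono (Metric.ball_subset_ball ?_)))
    exact Real.rpow_le_rpow_of_exponent_le hℓ1.le (by linarith)
  simp only [hpow] at h1 h2
  have hψ : Tendsto (fun t => ψ t / t) atTop (𝓝 L) := tendsto_div_of_squeeze hmono ha hb h1 h2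
  have ht : Tendsto (fun r : ℝ => -Real.log r / Real.log ℓ) (𝓝[>] 0) atTop :=
    (tendsto_neg_atBot_atTop.comp Real.tendsto_log_nhdsGT_zero).atTop_div_const hlog
  refine ((hψ.comp ht).div_const (Real.log ℓ)).congr' ?_
  filter_upwards [self_mem_nhdsWithin] with r hr
  have hr0 : 0 < r := hr
  have hrr : (ℓ : ℝ) ^ (-(-Real.log r / Real.log ℓ)) = r := by
    rw [Real.rpow_def_of_pos hℓ0, neg_div, neg_neg, mul_div_cancel₀ _ hlog.ne', Real.exp_log hr0]
  simp only [Function.comp, ψ, hrr]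
  rcases eq_or_ne (Real.log r) 0 with h | h
  · simp [h]
  · field_simp

theorem exists_adicInterval_subset_ball [NeZero ℓ] (hℓ : 1 < ℓ) {x r : ℝ}
    (hx : x ∈ Ico (0 : ℝ) 1) (hr : 0 < r) :
    ∃ n, adicInterval (adicWord ℓ n x) ⊆ Metric.ball x r := by
  obtain ⟨n, hn⟩ := exists_pow_lt_of_lt_one hr (show (1 / (ℓ : ℝ)) < 1 by
    rw [div_lt_one (by positivity)]
    exact_mod_cast hℓ)
  rw [one_div_pow] at hn
  exact ⟨n, adicInterval_subset_ball (mem_adicInterval_adicWord hx n) hn.le⟩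

/-- For points whose digits have no long runs of `0` or of `ℓ - 1`, the local dimension may be
computed with `ℓ`-adic intervals. -/
theorem tendsto_localDim [IsFiniteMeasure m] [NeZero ℓ] (hℓ : 1 < ℓ) {x L : ℝ}
    (hx : x ∈ Ico (0 : ℝ) 1) (hpos : ∀ n, 0 < m.real (adicInterval (adicWord ℓ n x)))
    (hL : Tendsto (fun n : ℕ => -Real.log (m.real (adicInterval (adicWord ℓ n x))) / n)
      atTop (𝓝 L))
    (h0 : ∀ ε : ℝ, 0 < ε → ∀ᶠ n : ℕ in atTop,
      ∃ i < ⌈ε * n⌉₊ + 1, (Real.digits x ℓ (n + i) : ℕ) ≠ 0)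
    (h1 : ∀ ε : ℝ, 0 < ε → ∀ᶠ n : ℕ in atTop,
      ∃ i < ⌈ε * n⌉₊ + 1, (Real.digits x ℓ (n + i) : ℕ) ≠ ℓ - 1) :
    Tendsto (fun r : ℝ => Real.log (m.real (Metric.ball x r)) / Real.log r) (𝓝[>] 0)
      (𝓝 (L / Real.log ℓ)) := by
  have hball : ∀ r, 0 < r → 0 < m.real (Metric.ball x r) := fun r hr => by
    obtain ⟨n, hn⟩ := exists_adicInterval_subset_ball hℓ hx hr
    exact (hpos n).trans_le (measureReal_mono hn)
  refine tendsto_log_ball_div_log hℓ hL hL hball (fun n => ?_) fun ε hε => ?_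
  · exact neg_le_neg (Real.log_le_log (hpos n) (measureReal_mono
      (adicInterval_subset_ball (mem_adicInterval_adicWord hx n) le_rfl)))
  · filter_upwards [h0 ε hε, h1 ε hε] with n hn0 hn1
    refine neg_le_neg (Real.log_le_log (hball _ (by positivity)) (measureReal_mono ?_))
    exact ball_subset_adicInterval (a := Real.digits x ℓ)
      (mem_adicInterval_adicWord (ℓ := ℓ) hx (n + (⌈ε * n⌉₊ + 1))) hn0 hn1

variable {m' : Measure ℝ} {p' : Fin ℓ → ℝ} {P' : Matrix (Fin ℓ) (Fin ℓ) ℝ}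

theorem wordWeight_ne_zero_iff {n : ℕ} (w : Fin (n + 1) → Fin ℓ) :
    wordWeight p P w ≠ 0 ↔ p (w 0) ≠ 0 ∧ ∀ k : Fin n, P (w k.castSucc) (w k.succ) ≠ 0 := by
  simp [wordWeight, Finset.prod_ne_zero_iff]

theorem IsMarkovMeasure.ae_wordWeight_ne_zero (hm : IsMarkovMeasure m p P) [NeZero ℓ] :
    ∀ᵐ x ∂m, ∀ n, wordWeight p P (adicWord ℓ (n + 1) x) ≠ 0 := by
  classical
  rw [ae_all_iff]
  intro n
  have h := hm.measure_le_sum (Finset.univ.filter fun w : Fin (n + 1) → Fin ℓ =>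
    wordWeight p P w = 0)
  rw [Finset.sum_eq_zero fun w hw => (Finset.mem_filter.1 hw).2, ENNReal.ofReal_zero] at h
  filter_upwards [hm.ae_mem_Ico, measure_eq_zero_iff_ae_notMem.1 (le_zero_iff.1 h)] with x hx hx' h0
  exact hx' ⟨hx, Finset.mem_filter.2 ⟨Finset.mem_univ _, h0⟩⟩

theorem tendsto_log_wordWeight {d : ℕ → Fin ℓ} {c : ℝ}
    (h0 : ∀ n, wordWeight p P (fun k : Fin (n + 1) => d k) ≠ 0)
    (h : Tendsto (fun n : ℕ => (∑ k ∈ Finset.range n, -Real.log (P (d k) (d (k + 1)))) / n)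
      atTop (𝓝 c)) :
    Tendsto (fun n : ℕ => -Real.log (wordWeight p P (fun k : Fin (n + 1) => d k)) /
      ((n + 1 : ℕ) : ℝ)) atTop (𝓝 c) := by
  have h1 : Tendsto (fun n : ℕ => (n : ℝ) / (n + 1 : ℕ)) atTop (𝓝 1) := by
    simpa using tendsto_natCast_div_add_atTop (1 : ℝ)
  have h2 : Tendsto (fun n : ℕ => -Real.log (p (d 0)) / ((n + 1 : ℕ) : ℝ)) atTop (𝓝 0) :=
    (tendsto_const_div_atTop_nhds_zero_nat _).comp (tendsto_add_atTop_nat 1)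
  have h3 := (h.mul h1).add h2
  rw [mul_one, add_zero] at h3
  refine h3.congr' ?_
  filter_upwards [eventually_gt_atTop 0] with n hn
  have hn0 : (n : ℝ) ≠ 0 := by exact_mod_cast hn.ne'
  have hw := (wordWeight_ne_zero_iff _).1 (h0 n)
  have hlog : Real.log (wordWeight p P (fun k : Fin (n + 1) => d k)) =
      Real.log (p (d 0)) + ∑ k ∈ Finset.range n, Real.log (P (d k) (d (k + 1))) := by
    rw [wordWeight, Real.log_mul hw.1 (Finset.prod_ne_zero_iff.2 fun k _ => hw.2 k),
      Real.log_prod (fun k _ => hw.2 k), Finset.sum_range]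
    rfl
  rw [hlog, Finset.sum_neg_distrib]
  have hn1 : ((n + 1 : ℕ) : ℝ) ≠ 0 := by positivity
  field_simp
  ring

/-- The local dimension of a Markov measure `m` at the typical points of a second Markov
measure `m'`: it is the cross entropy divided by `log ℓ`. -/
theorem IsMarkovMeasure.ae_localDim (hm' : IsMarkovMeasure m' p' P') (hm : IsMarkovMeasure m p P)
    [NeZero ℓ] (hℓ : 1 < ℓ) (hP' : P'.IsIrreducible) (hP1' : ∀ i j, P' i j ≠ 1)
    (hp : ∀ i, p' i ≠ 0 → p i ≠ 0) (hPP : ∀ i j, P' i j ≠ 0 → P i j ≠ 0) {c : ℝ} {u : Fin ℓ → ℝ}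
    (hc : IsPoissonSolution P' (fun i => ∑ j, P' i j * -Real.log (P i j)) c u) :
    ∀ᵐ x ∂m', x ∈ Ico (0 : ℝ) 1 ∧ (∀ n, 0 < m.real (adicInterval (adicWord ℓ n x))) ∧
      Tendsto (fun n : ℕ => -Real.log (m.real (adicInterval (adicWord ℓ n x))) / n)
        atTop (𝓝 c) ∧ x ∈ levelSet m (c / Real.log ℓ) := by
  have hfin := hm.isProbabilityMeasure
  filter_upwards [hm'.ae_mem_Ico, hm'.ae_wordWeight_ne_zero,
    hm'.ae_eventually_exists_digit_ne hP' hP1' ⟨0, by lia⟩,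
    hm'.ae_eventually_exists_digit_ne hP' hP1' ⟨ℓ - 1, by lia⟩,
    hm'.ae_tendsto_average (f := fun i j => -Real.log (P i j)) hc] with x hx hw h0 h1 havg
  have hw' : ∀ n, wordWeight p P (adicWord ℓ (n + 1) x) ≠ 0 := by
    intro n
    have h := (wordWeight_ne_zero_iff _).1 (hw n)
    exact (wordWeight_ne_zero_iff _).2 ⟨hp _ h.1, fun k => hPP _ _ (h.2 k)⟩
  have hpos' : ∀ n, 0 < m.real (adicInterval (adicWord ℓ (n + 1) x)) := fun n => by
    rw [hm.real_adicInterval]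
    exact lt_of_le_of_ne (wordWeight_nonneg hm.nonneg hm.matrix_nonneg _) (Ne.symm (hw' n))
  have hpos : ∀ n, 0 < m.real (adicInterval (adicWord ℓ n x)) := fun n =>
    (hpos' n).trans_le (measureReal_mono (adicInterval_subset_init _))
  have hL : Tendsto (fun n : ℕ => -Real.log (m.real (adicInterval (adicWord ℓ n x))) / n)
      atTop (𝓝 c) := by
    rw [← tendsto_add_atTop_iff_nat 1]
    simp only [hm.real_adicInterval]
    exact tendsto_log_wordWeight hw' havg
  refine ⟨hx, hpos, hL, ?_, tendsto_localDim hℓ hx hpos hL ?_ ?_⟩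
  · refine (Measure.mem_support_iff_forall x).2 fun U hU => ?_
    obtain ⟨r, hr, hrU⟩ := Metric.mem_nhds_iff.1 hU
    obtain ⟨n, hn⟩ := exists_adicInterval_subset_ball hℓ hx hr
    have h2 : 0 < m (adicInterval (adicWord ℓ n x)) := (ENNReal.toReal_pos_iff.1 (hpos n)).1
    exact h2.trans_le (measure_mono (hn.trans hrU))
  · intro ε hε
    filter_upwards [h0 ε hε] with n ⟨i, hi, hne⟩
    exact ⟨i, hi, fun h => hne (Fin.ext h)⟩
  · intro ε hε
    filter_upwards [h1 ε hε] with n ⟨i, hi, hne⟩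
    exact ⟨i, hi, fun h => hne (Fin.ext h)⟩

end LocalDimension


/-! ### Hausdorff dimension of sets and measures -/

section Dimension

variable {ℓ : ℕ} {m : Measure ℝ} {p : Fin ℓ → ℝ} {P : Matrix (Fin ℓ) (Fin ℓ) ℝ}

/-- Covering bound: a set covered, for all large `n`, by `C ℓ ^ (n t)` closed `ℓ`-adic intervals of
order `n` has dimension at most `t`. -/
theorem dimH_le_of_adic_cover (hℓ : 1 < ℓ) {F : Set ℝ} {t C : ℝ} (ht : 0 ≤ t)
    (S : ∀ n : ℕ, Finset (Fin (n + 1) → Fin ℓ))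
    (hF : ∀ᶠ n in atTop, F ⊆ ⋃ w ∈ S n, closure (adicInterval w))
    (hS : ∀ n, ((S n).card : ℝ) * (1 / (ℓ : ℝ) ^ (n + 1)) ^ t ≤ C) :
    dimH F ≤ ENNReal.ofReal t := by
  have hℓ1 : (1 : ℝ) < ℓ := by exact_mod_cast hℓ
  have hdiam : ∀ n (w : Fin (n + 1) → Fin ℓ),
      Metric.ediam (closure (adicInterval w)) = ENNReal.ofReal (1 / (ℓ : ℝ) ^ (n + 1)) := by
    intro n w
    rw [closure_adicInterval, Real.ediam_Icc, add_sub_cancel_left]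
  have hr : Tendsto (fun n : ℕ => ENNReal.ofReal (1 / (ℓ : ℝ) ^ (n + 1))) atTop (𝓝 0) := by
    have h1 : Tendsto (fun n : ℕ => (1 / (ℓ : ℝ)) ^ (n + 1)) atTop (𝓝 0) :=
      (tendsto_pow_atTop_nhds_zero_of_lt_one (by positivity)
        ((div_lt_one (by positivity)).2 hℓ1)).comp (tendsto_add_atTop_nat 1)
    simpa [one_div_pow] using ENNReal.tendsto_ofReal h1
  have hH := Measure.hausdorffMeasure_le_liminf_sum t F
    (fun n : ℕ => ENNReal.ofReal (1 / (ℓ : ℝ) ^ (n + 1))) hr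
    (fun n (w : S n) => closure (adicInterval w.1))
    (Eventually.of_forall fun n w => (hdiam n w.1).le)
    (hF.mono fun n hn => by simpa [iUnion_subtype] using hn)
  have hle : μH[t] F ≤ ENNReal.ofReal C := by
    refine hH.trans ((liminf_le_liminf (Eventually.of_forall fun n => ?_)).trans
      (liminf_const (f := (atTop : Filter ℕ)) (ENNReal.ofReal C)).le)
    simp only [hdiam, Finset.sum_const, Finset.card_univ, Fintype.card_coe, nsmul_eq_mul]
    rw [ENNReal.ofReal_rpow_of_pos (by positivity), ← ENNReal.ofReal_natCast,
      ← ENNReal.ofReal_mul (by positivity)]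
    exact ENNReal.ofReal_le_ofReal (hS n)
  have hne : μH[(t.toNNReal : ℝ)] F ≠ ∞ := by
    rw [Real.coe_toNNReal t ht]
    exact ne_top_of_le_ne_top ENNReal.ofReal_ne_top hle
  exact dimH_le_of_hausdorffMeasure_ne_top hne

/-- The mass distribution principle, in terms of local dimensions. -/
theorem le_dimH_of_ae_localDim [IsFiniteMeasure m] {E : Set ℝ} (hE : m E ≠ 0) {d : ℝ}
    (h : ∀ᵐ x ∂m, Tendsto (fun r : ℝ => Real.log (m.real (Metric.ball x r)) / Real.log r)
      (𝓝[>] 0) (𝓝 d)) :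
    ENNReal.ofReal d ≤ dimH E := by
  have hs : ∀ s : ℝ, 0 < s → s < d → ENNReal.ofReal s ≤ dimH E := by
    intro s hs0 hsd
    -- On one of the sets `F N`, of positive outer measure, the bound for balls is uniform.
    let F : ℕ → Set ℝ := fun N => {x | x ∈ E ∧ ∀ r : ℝ, 0 < r → r < 1 / ((N : ℝ) + 1) →
      m.real (Metric.ball x r) ≤ r ^ s}
    obtain ⟨N, hN⟩ : ∃ N, m (F N) ≠ 0 := by
      by_contra! hF
      refine hE (measure_mono_null ?_ (measure_union_null (measure_iUnion_null hF) h))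
      intro x hx
      by_cases hxd : Tendsto (fun r : ℝ => Real.log (m.real (Metric.ball x r)) / Real.log r)
        (𝓝[>] 0) (𝓝 d)
      · left
        obtain ⟨ρ, hρ, hρ'⟩ := mem_nhdsGT_iff_exists_Ioo_subset.1 (hxd.eventually (lt_mem_nhds hsd))
        obtain ⟨N, hN⟩ := exists_nat_one_div_lt (show 0 < min ρ 1 from lt_min hρ one_pos)
        refine mem_iUnion.2 ⟨N, hx, fun r hr0 hr => ?_⟩
        have h1 : s < Real.log (m.real (Metric.ball x r)) / Real.log r :=
          hρ' ⟨hr0, (hr.trans hN).trans_le (min_le_left _ _)⟩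
        have hlog : Real.log r < 0 :=
          Real.log_neg hr0 ((hr.trans hN).trans_le (min_le_right _ _))
        rcases measureReal_nonneg.eq_or_lt (a := 0) (b := m.real (Metric.ball x r)) with h0 | h0
        · rw [← h0]
          positivity
        · rw [lt_div_iff_of_neg hlog, ← Real.log_rpow hr0] at h1
          exact ((Real.log_lt_log_iff h0 (by positivity)).1 h1).le
      · exact Or.inr hxd
    have hle : m.restrict (F N) ≤ μH[s] := by
      refine Measure.le_hausdorffMeasure s _ (ENNReal.ofReal (1 / (2 * ((N : ℝ) + 1))))
        (ENNReal.ofReal_pos.2 (by positivity)) fun A hA => ?_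
      refine (measure_mono subset_closure).trans ?_
      rw [Measure.restrict_apply isClosed_closure.measurableSet]
      rcases (closure A ∩ F N).eq_empty_or_nonempty with h0 | ⟨x, hxA, hxF⟩
      · simp [h0]
      have hfin : Metric.ediam (closure A) ≠ ∞ := by
        rw [Metric.ediam_closure]
        exact ne_top_of_le_ne_top ENNReal.ofReal_ne_top hA
      rw [← Metric.ediam_closure A] at hA ⊢
      set δ := (Metric.ediam (closure A)).toReal with hδ
      have hδ0 : 0 ≤ δ := ENNReal.toReal_nonneg
      have hδ1 : δ < 1 / ((N : ℝ) + 1) := by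
        have h1 : δ ≤ 1 / (2 * ((N : ℝ) + 1)) := ENNReal.toReal_le_of_le_ofReal (by positivity) hA
        refine h1.trans_lt (one_div_lt_one_div_of_lt (by positivity) ?_)
        have : (0 : ℝ) < (N : ℝ) + 1 := by positivity
        linarith
      rw [← ENNReal.ofReal_toReal hfin, ENNReal.ofReal_rpow_of_nonneg hδ0 hs0.le]
      -- Balls of radius `r > δ` are used, which also covers the case `δ = 0`.
      have hcont : Tendsto (fun r : ℝ => ENNReal.ofReal (r ^ s)) (𝓝[>] δ)
          (𝓝 (ENNReal.ofReal (δ ^ s))) :=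
        (ENNReal.continuous_ofReal.comp
          (Real.continuous_rpow_const hs0.le)).continuousAt.tendsto.mono_left nhdsWithin_le_nhds
      refine ge_of_tendsto hcont ?_
      filter_upwards [self_mem_nhdsWithin, mem_nhdsWithin_of_mem_nhds (Iio_mem_nhds hδ1)]
        with r hr hr1
      have hsub : closure A ∩ F N ⊆ Metric.ball x r := by
        intro y hy
        have h2 := Metric.edist_le_ediam_of_mem hy.1 hxA
        rw [Metric.mem_ball]
        refine lt_of_le_of_lt ?_ (show δ < r from hr)
        rw [dist_edist]
        exact ENNReal.toReal_mono hfin h2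
      refine (measure_mono hsub).trans ?_
      rw [← ofReal_measureReal]
      exact ENNReal.ofReal_le_ofReal (hxF.2 r (hδ0.trans_lt hr) hr1)
    have hpos : μH[(s.toNNReal : ℝ)] (F N) ≠ 0 := by
      rw [Real.coe_toNNReal s hs0.le]
      intro h0
      have h1 := hle (F N)
      rw [h0, Measure.restrict_apply_self] at h1
      exact hN (le_zero_iff.1 h1)
    exact (le_dimH_of_hausdorffMeasure_ne_zero hpos).trans (dimH_mono fun x hx => hx.1)
  rcases le_or_gt d 0 with hd | hd
  · rw [ENNReal.ofReal_of_nonpos hd]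
    exact zero_le
  · have hcont : Tendsto ENNReal.ofReal (𝓝[<] d) (𝓝 (ENNReal.ofReal d)) :=
      ENNReal.continuous_ofReal.continuousAt.tendsto.mono_left nhdsWithin_le_nhds
    refine le_of_tendsto hcont ?_
    filter_upwards [self_mem_nhdsWithin, mem_nhdsWithin_of_mem_nhds (Ioi_mem_nhds hd)] with s h1 h2
    exact hs s h2 h1

/-- At most `ℓ ^ (n t)` intervals of order `n` have mass at least `ℓ ^ (- n t)`, so the set of
points whose intervals have mass `ℓ ^ (- n d + o(n))` has dimension at most `d`. -/
theorem IsMarkovMeasure.dimH_setOf_tendsto_le (hm : IsMarkovMeasure m p P) [NeZero ℓ] (hℓ : 1 < ℓ)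
    {c : ℝ} (hc0 : 0 ≤ c) :
    dimH {x | x ∈ Ico (0 : ℝ) 1 ∧ (∀ n, 0 < m.real (adicInterval (adicWord ℓ n x))) ∧
      Tendsto (fun n : ℕ => -Real.log (m.real (adicInterval (adicWord ℓ n x))) / n)
        atTop (𝓝 c)} ≤ ENNReal.ofReal (c / Real.log ℓ) := by
  classical
  have hℓ1 : (1 : ℝ) < ℓ := by exact_mod_cast hℓ
  have hℓ0 : (0 : ℝ) < ℓ := by linarith
  have hlog : 0 < Real.log ℓ := Real.log_pos hℓ1
  set G := {x | x ∈ Ico (0 : ℝ) 1 ∧ (∀ n, 0 < m.real (adicInterval (adicWord ℓ n x))) ∧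
      Tendsto (fun n : ℕ => -Real.log (m.real (adicInterval (adicWord ℓ n x))) / n)
        atTop (𝓝 c)}
  have ht : ∀ t : ℝ, c / Real.log ℓ < t → dimH G ≤ ENNReal.ofReal t := by
    intro t ht
    have ht0 : 0 < t := (div_nonneg hc0 hlog.le).trans_lt ht
    let S : ∀ n : ℕ, Finset (Fin (n + 1) → Fin ℓ) := fun n =>
      Finset.univ.filter fun w => (1 / (ℓ : ℝ) ^ (n + 1)) ^ t ≤ m.real (adicInterval w)
    let F : ℕ → Set ℝ := fun N => {x | x ∈ Ico (0 : ℝ) 1 ∧ ∀ n, N ≤ n →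
      adicWord ℓ (n + 1) x ∈ S n}
    have hGF : G ⊆ ⋃ N, F N := by
      rintro x ⟨hx, hpos, hlim⟩
      have hct : c < t * Real.log ℓ := (div_lt_iff₀ hlog).1 ht
      obtain ⟨N, hN⟩ := eventually_atTop.1 (((tendsto_add_atTop_iff_nat 1).2 hlim).eventually
        (gt_mem_nhds hct))
      refine mem_iUnion.2 ⟨N, hx, fun n hn => Finset.mem_filter.2 ⟨Finset.mem_univ _, ?_⟩⟩
      have h1 := hN n hn
      rw [div_lt_iff₀ (by positivity)] at h1
      rw [← Real.log_le_log_iff (by positivity) (hpos _), Real.log_rpow (by positivity),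
        Real.log_div one_ne_zero (by positivity), Real.log_one, Real.log_pow]
      linarith
    refine (dimH_mono hGF).trans ?_
    rw [dimH_iUnion]
    refine iSup_le fun N => dimH_le_of_adic_cover hℓ ht0.le S (C := 1) ?_ fun n => ?_
    · filter_upwards [eventually_ge_atTop N] with n hn x hx
      exact mem_iUnion₂.2 ⟨_, hx.2 n hn, subset_closure (mem_adicInterval_adicWord hx.1 _)⟩
    · rw [← nsmul_eq_mul, ← Finset.sum_const]
      refine ((Finset.sum_le_sum fun w hw => ?_).trans (Finset.sum_le_sum_of_subset_of_nonneg
        (Finset.subset_univ (S n)) fun w _ _ =>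
          wordWeight_nonneg hm.nonneg hm.matrix_nonneg w)).trans
        (sum_wordWeight_eq_one hm.sum_eq_one hm.sum_row_eq_one n).le
      rw [← hm.real_adicInterval]
      exact (Finset.mem_filter.1 hw).2
  have hcont : Tendsto ENNReal.ofReal (𝓝[>] (c / Real.log ℓ))
      (𝓝 (ENNReal.ofReal (c / Real.log ℓ))) :=
    ENNReal.continuous_ofReal.continuousAt.tendsto.mono_left nhdsWithin_le_nhds
  refine ge_of_tendsto hcont ?_
  filter_upwards [self_mem_nhdsWithin] with t h
  exact ht t h

theorem IsMarkovMeasure.hasDim (hm : IsMarkovMeasure m p P) [NeZero ℓ] (hℓ : 1 < ℓ)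
    (hP : P.IsIrreducible) (hP1 : ∀ i j, P i j ≠ 1) {c : ℝ} {u : Fin ℓ → ℝ} (hc0 : 0 ≤ c)
    (hc : IsPoissonSolution P (fun i => ∑ j, P i j * -Real.log (P i j)) c u) :
    HasDim m (ENNReal.ofReal (c / Real.log ℓ)) := by
  have hprob := hm.isProbabilityMeasure
  have hae := hm.ae_localDim hm hℓ hP hP1 (fun _ h => h) (fun _ _ h => h) hc
  have hlow : ∀ E : Set ℝ, m E ≠ 0 → ENNReal.ofReal (c / Real.log ℓ) ≤ dimH E := fun E hE =>
    le_dimH_of_ae_localDim hE (hae.mono fun x hx => hx.2.2.2.2)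
  have hlower : ENNReal.ofReal (c / Real.log ℓ) ≤ lowerDim m :=
    le_iInf fun E => le_iInf fun _ => le_iInf fun hE => hlow E hE.ne'
  have hcompare : lowerDim m ≤ upperDim m :=
    le_iInf fun E => le_iInf fun hEm => le_iInf fun hE =>
      iInf_le_of_le E (iInf_le_of_le hEm (iInf_le _ (by rw [hE]; exact one_pos)))
  have hupper : upperDim m ≤ ENNReal.ofReal (c / Real.log ℓ) := by
    have hG := hae.mono fun x hx => (⟨hx.1, hx.2.1, hx.2.2.1⟩ :
      x ∈ {x | x ∈ Ico (0 : ℝ) 1 ∧ (∀ n, 0 < m.real (adicInterval (adicWord ℓ n x))) ∧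
      Tendsto (fun n : ℕ => -Real.log (m.real (adicInterval (adicWord ℓ n x))) / n)
        atTop (𝓝 c)})
    obtain ⟨T, hT, hTm, hT0⟩ := exists_measurable_superset_of_null (mem_ae_iff.1 hG)
    refine iInf_le_of_le Tᶜ (iInf_le_of_le hTm.compl (iInf_le_of_le ?_ ?_))
    · exact (prob_compl_eq_one_iff hTm).2 hT0
    · exact (dimH_mono (compl_subset_comm.1 hT)).trans (hm.dimH_setOf_tendsto_le hℓ hc0)
  exact ⟨le_antisymm (hcompare.trans hupper) hlower,
    le_antisymm hupper (hlower.trans hcompare)⟩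

end Dimension


/-! ### Existence of Markov measures -/

section Existence

variable {ℓ : ℕ} {q : Fin ℓ → ℝ} {P : Matrix (Fin ℓ) (Fin ℓ) ℝ}

/-- The measure on `Fin ℓ` with the weights `q`. -/
noncomputable def vecMeasure (q : Fin ℓ → ℝ) : Measure (Fin ℓ) :=
  ∑ i, ENNReal.ofReal (q i) • Measure.dirac i

theorem vecMeasure_singleton (q : Fin ℓ → ℝ) (i : Fin ℓ) :
    vecMeasure q {i} = ENNReal.ofReal (q i) := by
  classical
  simp [vecMeasure, Measure.finsetSum_apply, Set.indicator_apply]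

theorem isProbabilityMeasure_vecMeasure (h0 : ∀ i, 0 ≤ q i) (h1 : ∑ i, q i = 1) :
    IsProbabilityMeasure (vecMeasure q) := by
  constructor
  simp [vecMeasure, Measure.finsetSum_apply, ← ENNReal.ofReal_sum_of_nonneg fun i _ => h0 i, h1]

/-- The chain is realised by its coordinates on the sequence space, with the measure given by the
Ionescu-Tulcea theorem. -/
theorem exists_isMarkovChain (hq0 : ∀ i, 0 ≤ q i) (hq1 : ∑ i, q i = 1) (h0 : ∀ i j, 0 ≤ P i j)
    (h1 : ∀ i, ∑ j, P i j = 1) :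
    ∃ μ : Measure (ℕ → Fin ℓ), IsProbabilityMeasure μ ∧
      IsMarkovChain μ (fun n x => x n) q P := by
  have hprow : ∀ i, IsProbabilityMeasure (vecMeasure (P i)) := fun i =>
    isProbabilityMeasure_vecMeasure (h0 i) (h1 i)
  have hpq := isProbabilityMeasure_vecMeasure hq0 hq1
  let κ : (n : ℕ) → ProbabilityTheory.Kernel (Π _ : Finset.Iic n, Fin ℓ) (Fin ℓ) := fun n =>
    ProbabilityTheory.Kernel.ofFunOfCountable fun z => vecMeasure (P (z ⟨n, by simp⟩))
  have hκ : ∀ n, ProbabilityTheory.IsMarkovKernel (κ n) := fun n => ⟨fun z => hprow _⟩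
  let μ : Measure (ℕ → Fin ℓ) :=
    ProbabilityTheory.Kernel.trajMeasure (X := fun _ => Fin ℓ) (vecMeasure q) κ
  have hμ : IsProbabilityMeasure μ := inferInstanceAs
    (IsProbabilityMeasure (ProbabilityTheory.Kernel.trajMeasure (X := fun _ => Fin ℓ) _ κ))
  refine ⟨μ, hμ, fun n => measurable_pi_apply n, Matrix.mem_rowStochastic_iff_sum.2 ⟨h0, h1⟩,
    fun i => ?_, fun n ε j => ?_⟩
  · have hmap : μ.map (Preorder.frestrictLe 0) =
        (vecMeasure q).map (MeasurableEquiv.piUnique (fun _ : Finset.Iic 0 => Fin ℓ)).symm := by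
      simp only [μ, ProbabilityTheory.Kernel.trajMeasure]
      rw [Measure.map_comp _ _ (by fun_prop), ProbabilityTheory.Kernel.traj_map_frestrictLe,
        ProbabilityTheory.Kernel.partialTraj_self]
      exact Measure.id_comp
    let z : Π _ : Finset.Iic 0, Fin ℓ := fun _ => i
    have hz := DFunLike.congr_fun hmap {z}
    rw [Measure.map_apply (by fun_prop) (measurableSet_singleton _),
      Measure.map_apply (by fun_prop) (measurableSet_singleton _)] at hz
    have e1 : Preorder.frestrictLe (π := fun _ => Fin ℓ) 0 ⁻¹' {z} = {x | x 0 = i} := by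
      ext x
      simp only [mem_preimage, mem_singleton_iff, mem_ofPred_eq, funext_iff]
      constructor
      · intro h
        exact h ⟨0, by simp⟩
      · rintro h ⟨k, hk⟩
        have hk0 : k = 0 := by simpa using hk
        subst hk0
        exact h
    have e2 : (MeasurableEquiv.piUnique (fun _ : Finset.Iic 0 => Fin ℓ)).symm ⁻¹' {z} = {i} := by
      ext a
      simp only [mem_preimage, mem_singleton_iff]
      constructor
      · intro h
        have := congrFun h default
        simpa [z] using this
      · rintro rfl
        funext k
        rw [Subsingleton.elim k default]
        simp [z]
    rw [e1, e2, vecMeasure_singleton] at hz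
    rw [measureReal_def, hz, ENNReal.toReal_ofReal (hq0 i)]
  · have hstep := ProbabilityTheory.Kernel.map_frestrictLe_trajMeasure_compProd_eq_map_trajMeasure
      (X := fun _ => Fin ℓ) (κ := κ) (μ₀ := vecMeasure q) (a := n)
    let z : Π _ : Finset.Iic n, Fin ℓ := fun k => ε ⟨k.1, by have := Finset.mem_Iic.1 k.2; lia⟩
    have hz := DFunLike.congr_fun hstep ({z} ×ˢ {j})
    rw [Measure.compProd_apply_prod (measurableSet_singleton _) (measurableSet_singleton _),
      lintegral_singleton, Measure.map_apply (by fun_prop) (measurableSet_singleton _),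
      Measure.map_apply (by fun_prop)
        ((measurableSet_singleton _).prod (measurableSet_singleton _))] at hz
    have e1 : Preorder.frestrictLe (π := fun _ => Fin ℓ) n ⁻¹' {z} =
        {x | ∀ k : Fin (n + 1), x k = ε k} := by
      ext x
      simp only [mem_preimage, mem_singleton_iff, mem_ofPred_eq, funext_iff]
      constructor
      · intro h k
        exact h ⟨k.1, by simpa using Nat.lt_succ_iff.1 k.2⟩
      · rintro h ⟨k, hk⟩
        exact h ⟨k, by have := Finset.mem_Iic.1 hk; lia⟩
    have e2 : (fun x : ℕ → Fin ℓ => (Preorder.frestrictLe (π := fun _ => Fin ℓ) n x, x (n + 1))) ⁻¹'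
        ({z} ×ˢ {j}) = {x | (∀ k : Fin (n + 1), x k = ε k) ∧ x (n + 1) = j} := by
      ext x
      have := congrArg (fun S => x ∈ S) e1
      simp only [mem_preimage, mem_singleton_iff, mem_ofPred_eq] at this
      simp [this]
    have e3 : κ n z {j} = ENNReal.ofReal (P (ε (Fin.last n)) j) := vecMeasure_singleton _ _
    rw [e1, e2, e3] at hz
    rw [measureReal_def, measureReal_def, ← hz, ENNReal.toReal_mul,
      ENNReal.toReal_ofReal (h0 _ _), mul_comm]

theorem tendsto_leftEnd (a : ℕ → Fin ℓ) : Tendsto (leftEnd a) atTop (𝓝 (Real.ofDigits a)) := by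
  have h := (Real.summable_ofDigitsTerm (digits := a)).hasSum.tendsto_sum_nat
  exact h

/-- Sequences ending in `ℓ - 1` only are excluded: they code the right end point, which does not
belong to the half-open interval. -/
theorem ofDigits_mem_adicInterval (hℓ : 1 < ℓ) {a : ℕ → Fin ℓ}
    (h : ∀ n, ∃ k, n ≤ k ∧ (a k : ℕ) ≠ ℓ - 1) (n : ℕ) :
    Real.ofDigits a ∈ adicInterval (fun k : Fin n => a k) := by
  have hℓ1 : (1 : ℝ) < ℓ := by exact_mod_cast hℓ
  rw [adicInterval_seq]
  refine ⟨(leftEnd_mono a).ge_of_tendsto (tendsto_leftEnd a) n, ?_⟩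
  obtain ⟨k, hk, hak⟩ := h n
  have h1 : Tendsto (fun n => leftEnd a n + 1 / (ℓ : ℝ) ^ n) atTop (𝓝 (Real.ofDigits a)) := by
    have h2 := tendsto_pow_atTop_nhds_zero_of_lt_one (r := 1 / (ℓ : ℝ)) (by positivity)
      ((div_lt_one (by positivity)).2 hℓ1)
    simpa [one_div_pow] using (tendsto_leftEnd a).add h2
  obtain ⟨i, rfl⟩ := Nat.exists_eq_add_of_le hk
  have h3 := (rightEnd_anti a).le_of_tendsto h1 (n + (i + 1))
  have h4 := rightEnd_add_le (a := a) (n := n) (k := i + 1) ⟨i, by lia, hak⟩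
  have h5 : 0 < 1 / (ℓ : ℝ) ^ (n + (i + 1)) := by positivity
  linarith

/-- The image of the law of the chain under the expansion in base `ℓ` is a Markov measure. -/
theorem exists_isMarkovMeasure (hℓ : 1 < ℓ) (hq0 : ∀ i, 0 ≤ q i) (hq1 : ∑ i, q i = 1)
    (h0 : ∀ i j, 0 ≤ P i j) (h1 : ∀ i, ∑ j, P i j = 1) (hP1 : ∀ i j, P i j ≠ 1) :
    ∃ m : Measure ℝ, IsMarkovMeasure m q P := by
  obtain ⟨μ, hμ, hX⟩ := exists_isMarkovChain hq0 hq1 h0 h1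
  have hcyl := hX.real_word
  have hsingle : ∀ y : ℕ → Fin ℓ, μ {y} = 0 := by
    intro y
    obtain ⟨c, hc0, hc1, hc⟩ := exists_bound_lt_one h0 h1 hP1
    have hq : ∀ i, q i ≤ 1 := fun i => by
      rw [← hq1]
      exact Finset.single_le_sum (fun k _ => hq0 k) (Finset.mem_univ i)
    have hle : ∀ n : ℕ, μ.real {y} ≤ c ^ n := fun n =>
      calc μ.real {y} ≤ μ.real {x | ∀ k : Fin (n + 1), x k = y k} :=
            measureReal_mono (singleton_subset_iff.2 fun _ => rfl)
        _ = wordWeight q P (fun k : Fin (n + 1) => y k) := hcyl n _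
        _ ≤ c ^ n := wordWeight_le_pow hq h0 hc _
    exact (measureReal_eq_zero_iff).1 (le_antisymm
      (ge_of_tendsto' (tendsto_pow_atTop_nhds_zero_of_lt_one hc0 hc1) hle) measureReal_nonneg)
  -- Sequences that are eventually equal to `ℓ - 1` are countably many, hence negligible.
  have hae : ∀ᵐ x ∂μ, ∀ n, ∃ k, n ≤ k ∧ (x k : ℕ) ≠ ℓ - 1 := by
    rw [ae_all_iff]
    intro n
    have hnull : μ (⋃ w : Fin n → Fin ℓ,
        {fun k => if h : k < n then w ⟨k, h⟩ else ⟨ℓ - 1, by lia⟩}) = 0 :=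
      measure_iUnion_null fun w => hsingle _
    refine measure_mono_null (fun x hx => ?_) hnull
    have hx' : ∀ k, n ≤ k → (x k : ℕ) = ℓ - 1 := by
      simpa using hx
    refine mem_iUnion.2 ⟨fun k => x k, mem_singleton_iff.2 (funext fun k => ?_)⟩
    by_cases h : k < n
    · simp [h]
    · simp only [h, dite_false]
      exact Fin.ext (hx' k (not_lt.1 h))
  have hmeas : Measurable (Real.ofDigits (b := ℓ)) := Real.continuous_ofDigits.measurable
  refine ⟨μ.map Real.ofDigits, Measure.isProbabilityMeasure_map hmeas.aemeasurable, hq0, hq1,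
    h0, h1, fun n w => ?_⟩
  rw [measureReal_def, Measure.map_apply hmeas (measurableSet_adicInterval w), ← hcyl n w,
    measureReal_def]
  congr 1
  refine measure_congr ?_
  filter_upwards [hae] with x hx
  refine propext ⟨fun h k => ?_, fun h => ?_⟩
  · exact congrFun (eq_of_mem_adicInterval (ofDigits_mem_adicInterval hℓ hx (n + 1)) h) k
  · have := ofDigits_mem_adicInterval hℓ hx (n + 1)
    rwa [show (fun k : Fin (n + 1) => x k) = w from funext h] at this

end Existence


/-! ### The normalized matrix -/

section Normalized

variable {ι : Type*} [Fintype ι] {A N : Matrix ι ι ℝ} {t : ℝ} {v : ι → ℝ}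

theorem normalized_apply {ℓ : ℕ} {A : Matrix (Fin ℓ) (Fin ℓ) ℝ} {v : Fin ℓ → ℝ}
    (hv : ∀ i, 0 < v i) (i j : Fin ℓ) :
    normalized A v i j = A i j * v j / (specRadius A * v i) := by
  have hinv : (Matrix.diagonal v)⁻¹ = Matrix.diagonal fun i => (v i)⁻¹ := by
    refine Matrix.inv_eq_right_inv ?_
    rw [Matrix.diagonal_mul_diagonal, ← Matrix.diagonal_one]
    congr 1
    funext i
    exact mul_inv_cancel₀ (hv i).ne'
  rw [normalized, hinv, Matrix.smul_apply, Matrix.mul_diagonal, Matrix.diagonal_mul, smul_eq_mul,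
    div_eq_mul_inv, mul_inv]
  ring

theorem normalized_nonneg {ι : Type*} {A N : Matrix ι ι ℝ} {v : ι → ℝ}
    (hA : ∀ i j, 0 ≤ A i j) (ht : 0 < t) (hv : ∀ i, 0 < v i)
    (hN : ∀ i j, N i j = A i j * v j / (t * v i)) (i j : ι) : 0 ≤ N i j := by
  rw [hN]
  exact div_nonneg (mul_nonneg (hA i j) (hv j).le) (mul_pos ht (hv i)).le

theorem normalized_ne_zero_iff {ι : Type*} {A N : Matrix ι ι ℝ} {v : ι → ℝ}
    (ht : 0 < t) (hv : ∀ i, 0 < v i)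
    (hN : ∀ i j, N i j = A i j * v j / (t * v i)) (i j : ι) : N i j ≠ 0 ↔ A i j ≠ 0 := by
  rw [hN]
  simp [(hv i).ne', (hv j).ne', ht.ne']

theorem sum_normalized (ht : 0 < t) (hv : ∀ i, 0 < v i) (hAv : A.mulVec v = t • v)
    (hN : ∀ i j, N i j = A i j * v j / (t * v i)) (i : ι) : ∑ j, N i j = 1 := by
  have h : ∑ j, A i j * v j = t * v i := congrFun hAv i
  simp only [hN, ← Finset.sum_div, h]
  exact div_self (mul_pos ht (hv i)).ne'

theorem isIrreducible_of_ne_zero_iff {ι : Type*} {A N : Matrix ι ι ℝ} (hA : A.IsIrreducible)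
    (hN0 : ∀ i j, 0 ≤ N i j) (h : ∀ i j, N i j ≠ 0 ↔ A i j ≠ 0) : N.IsIrreducible := by
  refine ⟨hN0, ?_⟩
  have hq : N.toQuiver = A.toQuiver := by
    have : ∀ i j, (0 < N i j) = (0 < A i j) := fun i j => by
      rw [(hN0 i j).lt_iff_ne', (hA.nonneg i j).lt_iff_ne']
      exact propext (h i j)
    simp only [Matrix.toQuiver, this]
  rw [hq]
  exact hA.connected

theorem ne_one_of_support {P : Matrix ι ι ℝ} (hN0 : ∀ i j, 0 ≤ N i j) (hN1 : ∀ i, ∑ j, N i j = 1)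
    (hP1 : ∀ i, ∑ j, P i j = 1) (hPne : ∀ i j, P i j ≠ 1) (h : ∀ i j, P i j ≠ 0 → N i j ≠ 0)
    (i j : ι) : N i j ≠ 1 := by
  classical
  intro hij
  have h0 : ∀ k, k ≠ j → N i k = 0 := by
    have h2 := hN1 i
    rw [← Finset.add_sum_erase _ _ (Finset.mem_univ j), hij, add_eq_left,
      Finset.sum_eq_zero_iff_of_nonneg fun k _ => hN0 i k] at h2
    exact fun k hk => h2 k (Finset.mem_erase.2 ⟨hk, Finset.mem_univ k⟩)
  refine hPne i j ?_
  rw [← hP1 i]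
  refine (Finset.sum_eq_single j (fun k _ hk => ?_) (by simp)).symm
  by_contra hne
  exact h i k hne (h0 k hk)

theorem isPoissonSolution_entropy_normalized (hA : ∀ i j, A i j = 0 ∨ A i j = 1) (ht : 0 < t)
    (hv : ∀ i, 0 < v i) (hAv : A.mulVec v = t • v)
    (hN : ∀ i j, N i j = A i j * v j / (t * v i)) :
    IsPoissonSolution N (fun i => ∑ j, N i j * -Real.log (N i j)) (Real.log t)
      (fun i => Real.log (v i)) := by
  have h := (isPoissonSolution_log_normalized ht hv hN (sum_normalized ht hv hAv hN)
    (fun i j hij => (hA i j).resolve_left ((normalized_ne_zero_iff ht hv hN i j).1 hij))).neg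
  convert h using 1
  · funext i
    simp
  · simp
  · funext i
    simp

variable {ℓ : ℕ} {p : Fin ℓ → ℝ} {A N : Matrix (Fin ℓ) (Fin ℓ) ℝ} {v : Fin ℓ → ℝ}

/-- The eigenvector factors telescope along a word. -/
theorem wordWeight_normalized (ht : 0 < t) (hv : ∀ i, 0 < v i)
    (hN : ∀ i j, N i j = A i j * v j / (t * v i)) {n : ℕ} (w : Fin (n + 1) → Fin ℓ) :
    wordWeight p N w = wordWeight p A w * (v (w (Fin.last n)) / v (w 0)) / t ^ n := by
  induction n with
  | zero =>
    have := (hv (w 0)).ne'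
    simp [wordWeight, this]
  | succ n ih =>
    obtain ⟨w', j, rfl⟩ : ∃ (w' : Fin (n + 1) → Fin ℓ) (j : Fin ℓ), w = Fin.snoc w' j :=
      ⟨Fin.init w, w (Fin.last _), (Fin.snoc_init_self w).symm⟩
    have h0 : (Fin.snoc w' j : Fin (n + 2) → Fin ℓ) 0 = w' 0 := by
      rw [← Fin.castSucc_zero, Fin.snoc_castSucc (α := fun _ => Fin ℓ)]
    rw [wordWeight_snoc, wordWeight_snoc, ih, hN, h0, Fin.snoc_last]
    have h1 := (hv (w' 0)).ne'
    have h2 := (hv (w' (Fin.last n))).ne'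
    field_simp
    ring

theorem wordWeight_eq_one_iff (hp : ∀ i, p i = 0 ∨ p i = 1) (hA : ∀ i j, A i j = 0 ∨ A i j = 1)
    {n : ℕ} (w : Fin (n + 1) → Fin ℓ) : wordWeight p A w = 1 ↔ wordWeight p A w ≠ 0 := by
  refine ⟨fun h => by rw [h]; exact one_ne_zero, fun h => ?_⟩
  obtain ⟨h1, h2⟩ := (wordWeight_ne_zero_iff w).1 h
  rw [wordWeight, (hp _).resolve_left h1, one_mul]
  exact Finset.prod_eq_one fun k _ => (hA _ _).resolve_left (h2 k)

theorem exists_bounds_wordWeight_normalized [NeZero ℓ] (hp0 : ∀ i, 0 ≤ p i) (hp1 : ∀ i, p i ≤ 1)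
    (hA : ∀ i j, A i j = 0 ∨ A i j = 1) (ht : 0 < t) (hv : ∀ i, 0 < v i)
    (hN : ∀ i j, N i j = A i j * v j / (t * v i)) :
    ∃ a b : ℝ, 0 < a ∧ 0 < b ∧ ∀ (n : ℕ) (w : Fin (n + 1) → Fin ℓ),
      wordWeight p N w ≤ b / t ^ n ∧ (wordWeight p N w ≠ 0 → a / t ^ n ≤ wordWeight p N w) := by
  classical
  obtain ⟨z, hz⟩ := Finite.exists_min (fun z : Fin ℓ × Fin ℓ => v z.1 / v z.2)
  obtain ⟨y, hy⟩ := Finite.exists_max (fun z : Fin ℓ × Fin ℓ => v z.1 / v z.2)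
  obtain ⟨k, hk⟩ := Finite.exists_min (fun i => if p i = 0 then 1 else p i)
  set pm := if p k = 0 then 1 else p k with hpm
  have hpm0 : 0 < pm := by
    rw [hpm]
    split_ifs with h
    · exact one_pos
    · exact lt_of_le_of_ne (hp0 k) (Ne.symm h)
  have hz0 : 0 < v z.1 / v z.2 := div_pos (hv _) (hv _)
  have hy0 : 0 < v y.1 / v y.2 := div_pos (hv _) (hv _)
  refine ⟨pm * (v z.1 / v z.2), v y.1 / v y.2, mul_pos hpm0 hz0, hy0, fun n w => ?_⟩
  have hA1 : ∀ i j, A i j ≤ 1 := fun i j => by rcases hA i j with h | h <;> simp [h]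
  have hA0 : ∀ i j, 0 ≤ A i j := fun i j => by rcases hA i j with h | h <;> simp [h]
  have hwA : wordWeight p A w ≤ 1 := by
    simpa using wordWeight_le_pow (P := A) hp1 hA0 hA1 w
  have hpos : 0 < v (w (Fin.last n)) / v (w 0) := div_pos (hv _) (hv _)
  rw [wordWeight_normalized ht hv hN]
  constructor
  · gcongr
    calc wordWeight p A w * (v (w (Fin.last n)) / v (w 0))
        ≤ 1 * (v (w (Fin.last n)) / v (w 0)) := by gcongr
      _ ≤ v y.1 / v y.2 := by
        rw [one_mul]
        exact hy (w (Fin.last n), w 0)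
  · intro hne
    have hne' : wordWeight p A w ≠ 0 := by
      rintro h
      simp [h] at hne
    obtain ⟨h1, h2⟩ := (wordWeight_ne_zero_iff w).1 hne'
    have hweq : wordWeight p A w = p (w 0) := by
      rw [wordWeight, Finset.prod_eq_one fun k _ => (hA _ _).resolve_left (h2 k), mul_one]
    have hpw : pm ≤ p (w 0) := by simpa [h1] using hk (w 0)
    rw [hweq]
    exact div_le_div_of_nonneg_right
      (mul_le_mul hpw (hz (w (Fin.last n), w 0)) hz0.le (hp0 _)) (by positivity)

end Normalized

/-! ### The Cantor set and the spectrum of a Markov measure -/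

section CantorSet

variable {ℓ : ℕ} {p₀ p q : Fin ℓ → ℝ} {P₀ P N : Matrix (Fin ℓ) (Fin ℓ) ℝ} {m : Measure ℝ}

/-- The interior of an `ℓ`-adic interval meets no closure of another one of the same order. -/
theorem wordWeight_eq_one_of_mem_interior {n : ℕ} {w : Fin (n + 1) → Fin ℓ} {x : ℝ}
    (hx : x ∈ interior (adicInterval w)) (hK : x ∈ cantorSet p₀ P₀) : wordWeight p₀ P₀ w = 1 := by
  obtain ⟨w', hw', hxw'⟩ := mem_iUnion₂.1 (mem_iInter.1 hK n)
  rw [eq_of_mem_interior_of_mem_closure hx hxw']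
  exact hw'

/-- Without atoms, an interval of positive mass has an interior of positive mass. -/
theorem IsMarkovMeasure.exists_mem_interior (hm : IsMarkovMeasure m p P)
    (hP1 : ∀ i j, P i j ≠ 1) {n : ℕ} {w : Fin (n + 1) → Fin ℓ} (hw : wordWeight p P w ≠ 0)
    {K : Set ℝ} (hK : ∀ᵐ x ∂m, x ∈ K) : ∃ x ∈ interior (adicInterval w), x ∈ K := by
  by_contra! h
  have h1 : m (interior (adicInterval w)) = 0 := measure_mono_null (fun x hx => h x hx) hK
  rw [hm.measure_interior_adicInterval hP1] at h1
  refine hw ?_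
  rw [← hm.real_adicInterval, measureReal_def, h1, ENNReal.toReal_zero]

/-- Every letter is the last letter of a word of positive weight, since the set of such letters is
closed under successors. -/
theorem exists_word_last (hP : P.IsIrreducible) (hp : ∃ i, p i ≠ 0) (i : Fin ℓ) :
    ∃ (n : ℕ) (w : Fin (n + 1) → Fin ℓ), wordWeight p P w ≠ 0 ∧ w (Fin.last n) = i := by
  obtain ⟨a, ha⟩ := hp
  have key := hP.eq_univ_of_closed (S := {i | ∃ (n : ℕ) (w : Fin (n + 1) → Fin ℓ),
    wordWeight p P w ≠ 0 ∧ w (Fin.last n) = i}) ⟨a, 0, fun _ => a, by simpa [wordWeight], rfl⟩ ?_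
  · exact (key ▸ mem_univ i : i ∈ {i | ∃ (n : ℕ) (w : Fin (n + 1) → Fin ℓ),
      wordWeight p P w ≠ 0 ∧ w (Fin.last n) = i})
  · rintro b ⟨n, w, hw, rfl⟩ j hj
    refine ⟨n + 1, Fin.snoc w j, ?_, Fin.snoc_last _ _⟩
    rw [wordWeight_snoc]
    exact mul_ne_zero hw hj.ne'

theorem matrix_ne_zero_of_wordWeight (hP : P.IsIrreducible) (hp : ∃ i, p i ≠ 0)
    (h : ∀ (n : ℕ) (w : Fin (n + 1) → Fin ℓ), wordWeight p P w ≠ 0 → wordWeight q N w ≠ 0)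
    (i j : Fin ℓ) (hij : P i j ≠ 0) : N i j ≠ 0 := by
  obtain ⟨n, w, hw, rfl⟩ := exists_word_last hP hp i
  have h1 := h (n + 1) (Fin.snoc w j) (by rw [wordWeight_snoc]; exact mul_ne_zero hw hij)
  rw [wordWeight_snoc] at h1
  exact right_ne_zero_of_mul h1

theorem vec_ne_zero_of_wordWeight
    (h : ∀ (n : ℕ) (w : Fin (n + 1) → Fin ℓ), wordWeight p P w ≠ 0 → wordWeight q N w ≠ 0)
    (i : Fin ℓ) (hi : p i ≠ 0) : q i ≠ 0 := by
  simpa [wordWeight] using h 0 (fun _ => i) (by simpa [wordWeight] using hi)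

theorem IsMarkovMeasure.ae_mem_cantorSet (hm : IsMarkovMeasure m p P)
    (h : ∀ (n : ℕ) (w : Fin (n + 1) → Fin ℓ), wordWeight p P w ≠ 0 → wordWeight p₀ P₀ w = 1) :
    ∀ᵐ x ∂m, x ∈ cantorSet p₀ P₀ := by
  have := hm.neZero
  filter_upwards [hm.ae_mem_Ico, hm.ae_wordWeight_ne_zero] with x hx hw
  exact mem_iInter.2 fun n => mem_iUnion₂.2
    ⟨_, h n _ (hw n), subset_closure (mem_adicInterval_adicWord hx _)⟩

/-- The number of admissible words of length `n + 1` is of order `t ^ n`, where `t` is the Perron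
eigenvalue. -/
theorem dimH_cantorSet_le [NeZero ℓ] (hℓ : 1 < ℓ) (hp₀ : ∀ i, p₀ i = 0 ∨ p₀ i = 1)
    (hP₀ : ∀ i j, P₀ i j = 0 ∨ P₀ i j = 1) {t : ℝ} (ht : 1 ≤ t) {v : Fin ℓ → ℝ}
    (hv : ∀ i, 0 < v i) (hPv : P₀.mulVec v = t • v) :
    dimH (cantorSet p₀ P₀) ≤ ENNReal.ofReal (Real.log t / Real.log ℓ) := by
  classical
  have hℓ1 : (1 : ℝ) < ℓ := by exact_mod_cast hℓ
  have hlog : 0 < Real.log ℓ := Real.log_pos hℓ1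
  have ht0 : 0 < t := by linarith
  have hp0 : ∀ i, 0 ≤ p₀ i := fun i => by rcases hp₀ i with h | h <;> simp [h]
  have hP0 : ∀ i j, 0 ≤ P₀ i j := fun i j => by rcases hP₀ i j with h | h <;> simp [h]
  obtain ⟨k, hk⟩ := Finite.exists_min v
  refine dimH_le_of_adic_cover hℓ (div_nonneg (Real.log_nonneg ht) hlog.le)
    (fun n => Finset.univ.filter fun w => wordWeight p₀ P₀ w = 1)
    (C := (∑ i, p₀ i * v i) / v k) (Eventually.of_forall fun n x hx => ?_) fun n => ?_
  · obtain ⟨w, hw, hxw⟩ := mem_iUnion₂.1 (mem_iInter.1 hx n)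
    exact mem_iUnion₂.2 ⟨w, Finset.mem_filter.2 ⟨Finset.mem_univ _, hw⟩, hxw⟩
  · have hcard : ((Finset.univ.filter fun w : Fin (n + 1) → Fin ℓ =>
        wordWeight p₀ P₀ w = 1).card : ℝ) * v k ≤ t ^ n * ∑ i, p₀ i * v i := by
      calc _ = ∑ w : Fin (n + 1) → Fin ℓ with wordWeight p₀ P₀ w = 1, v k := by
            rw [Finset.sum_const, nsmul_eq_mul]
        _ ≤ ∑ w : Fin (n + 1) → Fin ℓ with wordWeight p₀ P₀ w = 1,
            wordWeight p₀ P₀ w * v (w (Fin.last n)) :=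
            Finset.sum_le_sum fun w hw => by
              rw [(Finset.mem_filter.1 hw).2, one_mul]
              exact hk _
        _ ≤ ∑ w : Fin (n + 1) → Fin ℓ, wordWeight p₀ P₀ w * v (w (Fin.last n)) :=
            Finset.sum_le_sum_of_subset_of_nonneg (Finset.filter_subset _ _) fun w _ _ =>
              mul_nonneg (wordWeight_nonneg hp0 hP0 w) (hv _).le
        _ ≤ _ := sum_wordWeight_le hp0 hP0 ht0.le (fun i => (congrFun hPv i).le) n
    have hpow : (1 / (ℓ : ℝ) ^ (n + 1)) ^ (Real.log t / Real.log ℓ) = 1 / t ^ (n + 1) := by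
      rw [Real.rpow_def_of_pos (by positivity), Real.log_div one_ne_zero (by positivity),
        Real.log_one, Real.log_pow, zero_sub, neg_mul, mul_assoc, mul_div_cancel₀ _ hlog.ne',
        Real.exp_neg, ← Real.log_pow, Real.exp_log (by positivity), one_div]
    have hS0 : 0 ≤ ∑ i, p₀ i * v i := Finset.sum_nonneg fun i _ => mul_nonneg (hp0 i) (hv i).le
    rw [hpow, mul_one_div, div_le_div_iff₀ (by positivity) (hv k)]
    refine hcard.trans ?_
    rw [mul_comm]
    exact mul_le_mul_of_nonneg_left (pow_le_pow_right₀ ht n.le_succ) hS0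

/-- A ball of radius `ℓ ^ (- n)` meets at most four `ℓ`-adic intervals of order `n`. -/
theorem IsMarkovMeasure.real_ball_le (hm : IsMarkovMeasure m p P) {n : ℕ} {b : ℝ}
    (hb : ∀ w : Fin (n + 1) → Fin ℓ, wordWeight p P w ≤ b) (x : ℝ) :
    m.real (Metric.ball x (1 / (ℓ : ℝ) ^ (n + 1))) ≤ 4 * b := by
  classical
  have hprob := hm.isProbabilityMeasure
  have hne := hm.neZero
  have hℓ0 : (0 : ℝ) < ℓ := by exact_mod_cast NeZero.pos ℓ
  set ρ : ℝ := 1 / (ℓ : ℝ) ^ (n + 1) with hρ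
  have hρ0 : 0 < ρ := by positivity
  let S : Finset (Fin (n + 1) → Fin ℓ) :=
    Finset.univ.filter fun w => (adicInterval w ∩ Metric.ball x ρ).Nonempty
  have hcard : (S.card : ℝ) ≤ 4 := by
    have h1 : volume.real (⋃ w ∈ S, adicInterval w) = S.card * ρ := by
      rw [measureReal_biUnion_finset (fun w _ w' _ hww' => disjoint_left.2 fun y hy hy' =>
        hww' (eq_of_mem_adicInterval hy hy')) (fun w _ => measurableSet_adicInterval w)
        (fun w _ => by simp [adicInterval])]
      rw [← nsmul_eq_mul, ← Finset.sum_const]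
      refine Finset.sum_congr rfl fun w _ => ?_
      rw [adicInterval, Real.volume_real_Ico_of_le (by linarith), add_sub_cancel_left]
    have h2 : volume.real (⋃ w ∈ S, adicInterval w) ≤ volume.real (Metric.ball x (2 * ρ)) := by
      refine measureReal_mono (iUnion₂_subset fun w hw y hy => ?_) measure_ball_lt_top.ne
      obtain ⟨z, hz, hzx⟩ := (Finset.mem_filter.1 hw).2
      have h3 := adicInterval_subset_ball hz le_rfl hy
      rw [Metric.mem_ball] at h3 hzx ⊢
      linarith [dist_triangle y z x]
    rw [h1, Real.volume_real_ball (by positivity)] at h2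
    nlinarith
  have hb0 : 0 ≤ b :=
    (wordWeight_nonneg hm.nonneg hm.matrix_nonneg _).trans (hb (adicWord ℓ (n + 1) x))
  have hle : m (Metric.ball x ρ) ≤ ENNReal.ofReal (∑ w ∈ S, wordWeight p P w) := by
    refine le_trans ?_ (hm.measure_le_sum S)
    refine measure_mono_ae ?_
    filter_upwards [hm.ae_mem_Ico] with y hy hyx
    exact ⟨hy, Finset.mem_filter.2 ⟨Finset.mem_univ _, y, mem_adicInterval_adicWord hy _, hyx⟩⟩
  calc m.real (Metric.ball x ρ) ≤ ∑ w ∈ S, wordWeight p P w :=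
        ENNReal.toReal_le_of_le_ofReal
          (Finset.sum_nonneg fun w _ => wordWeight_nonneg hm.nonneg hm.matrix_nonneg w) hle
    _ ≤ ∑ _w ∈ S, b := Finset.sum_le_sum fun w _ => hb w
    _ = S.card * b := by rw [Finset.sum_const, nsmul_eq_mul]
    _ ≤ 4 * b := mul_le_mul_of_nonneg_right hcard hb0

/-- If the weights of the words of length `n` are comparable with `t ^ (- n)`, all points of the
Cantor set have the same local dimension. -/
theorem IsMarkovMeasure.mem_levelSet_of_bounds (hm : IsMarkovMeasure m p P) (hℓ : 1 < ℓ)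
    (hsupp : m.support = cantorSet p₀ P₀) {t a b : ℝ} (ht : 0 < t) (ha : 0 < a) (hb : 0 < b)
    (hub : ∀ (n : ℕ) (w : Fin (n + 1) → Fin ℓ), wordWeight p P w ≤ b / t ^ n)
    (hlb : ∀ (n : ℕ) (w : Fin (n + 1) → Fin ℓ), wordWeight p₀ P₀ w = 1 →
      a / t ^ n ≤ wordWeight p P w) {x : ℝ} (hx : x ∈ m.support) :
    x ∈ levelSet m (Real.log t / Real.log ℓ) := by
  have hprob := hm.isProbabilityMeasure
  have hℓ1 : (1 : ℝ) < ℓ := by exact_mod_cast hℓ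
  have hpos : ∀ r, 0 < r → 0 < m.real (Metric.ball x r) := fun r hr =>
    ENNReal.toReal_pos ((Measure.mem_support_iff_forall x).1 hx _ (Metric.ball_mem_nhds x hr)).ne'
      (measure_ne_top _ _)
  have hlim : ∀ C : ℝ, Tendsto (fun n : ℕ => (n * Real.log t - C) / n) atTop
      (𝓝 (Real.log t)) := by
    intro C
    have h := (tendsto_const_nhds (x := Real.log t)).sub (tendsto_const_div_atTop_nhds_zero_nat C)
    rw [sub_zero] at h
    refine h.congr' ?_
    filter_upwards [eventually_gt_atTop 0] with n hn
    have hn0 : (n : ℝ) ≠ 0 := by exact_mod_cast hn.ne'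
    field_simp
  refine ⟨hx, tendsto_log_ball_div_log hℓ (hlim (Real.log a)) (hlim (Real.log (4 * b))) hpos
    (fun n => ?_) fun ε _ => Eventually.of_forall fun n => ?_⟩
  · rw [hsupp] at hx
    obtain ⟨w, hw, hxw⟩ := mem_iUnion₂.1 (mem_iInter.1 hx n)
    have hsub : adicInterval w ⊆ Metric.ball x (1 / (ℓ : ℝ) ^ n) := by
      have h1 : 1 / (ℓ : ℝ) ^ (n + 1) < 1 / (ℓ : ℝ) ^ n :=
        one_div_lt_one_div_of_lt (by positivity) (pow_lt_pow_right₀ hℓ1 n.lt_succ_self)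
      rw [closure_adicInterval] at hxw
      intro y hy
      rw [adicInterval] at hy
      rw [Metric.mem_ball, Real.dist_eq, abs_lt]
      constructor <;> linarith [hy.1, hy.2, hxw.1, hxw.2]
    have h2 : a / t ^ n ≤ m.real (Metric.ball x (1 / (ℓ : ℝ) ^ n)) :=
      ((hlb n w hw).trans (hm.real_adicInterval n w).ge).trans (measureReal_mono hsub)
    have h3 := Real.log_le_log (by positivity) h2
    rw [Real.log_div ha.ne' (by positivity), Real.log_pow] at h3
    linarith
  · have h1 : m.real (Metric.ball x (1 / (ℓ : ℝ) ^ (n + (⌈ε * n⌉₊ + 1)))) ≤ 4 * (b / t ^ n) := by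
      refine le_trans (measureReal_mono (Metric.ball_subset_ball ?_)) (hm.real_ball_le (hub n) x)
      exact one_div_le_one_div_of_le (by positivity) (pow_le_pow_right₀ hℓ1.le (by lia))
    have h3 := Real.log_le_log (hpos _ (by positivity)) h1
    rw [← mul_div_assoc, Real.log_div (by positivity) (by positivity), Real.log_pow] at h3
    linarith

/-- The word sums of the squared weights grow at least like `exp (- n c)`: by Jensen's inequality
on each row, `exp (- u)` is a subeigenvector of the matrix of squared entries. -/
theorem IsMarkovMeasure.le_tau_two (hm : IsMarkovMeasure m p P) (hℓ : 1 < ℓ) {c : ℝ}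
    {u : Fin ℓ → ℝ} (hc : IsPoissonSolution P (fun i => ∑ j, P i j * -Real.log (P i j)) c u) :
    ((-(c / Real.log ℓ) : ℝ) : EReal) ≤ tau ℓ m 2 := by
  have hne := hm.neZero
  have hprob := hm.isProbabilityMeasure
  have hlog : 0 < Real.log ℓ := Real.log_pos (by exact_mod_cast hℓ)
  let Q : Matrix (Fin ℓ) (Fin ℓ) ℝ := Matrix.of fun i j => P i j ^ 2
  have hQ : ∀ i, Real.exp (-c) * Real.exp (-u i) ≤ Q.mulVec (fun j => Real.exp (-u j)) i := by
    intro i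
    have hterm : ∀ j, P i j * (Real.exp (-c - u i) *
        (Real.log (P i j) - u j + c + u i + 1)) ≤ Q i j * Real.exp (-u j) := by
      intro j
      rcases (hm.matrix_nonneg i j).eq_or_lt with h | h
      · simp [Q, ← h]
      · have h1 := Real.add_one_le_exp (Real.log (P i j) - u j + c + u i)
        have h2 : Real.exp (-c - u i) * Real.exp (Real.log (P i j) - u j + c + u i) =
            P i j * Real.exp (-u j) := by
          rw [← Real.exp_add, show -c - u i + (Real.log (P i j) - u j + c + u i) =
            Real.log (P i j) + -u j by ring, Real.exp_add, Real.exp_log h]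
        calc _ ≤ P i j * (Real.exp (-c - u i) * Real.exp (Real.log (P i j) - u j + c + u i)) := by
              gcongr
          _ = _ := by
              rw [h2]
              simp only [Q, Matrix.of_apply]
              ring
    have hsum : ∑ j, P i j * (Real.exp (-c - u i) * (Real.log (P i j) - u j + c + u i + 1)) =
        Real.exp (-c - u i) := by
      have h3 := hc i
      simp only [mul_neg, Finset.sum_neg_distrib, Matrix.mulVec, dotProduct] at h3
      have h4 : ∀ j, P i j * (Real.exp (-c - u i) * (Real.log (P i j) - u j + c + u i + 1)) =
          Real.exp (-c - u i) * (P i j * Real.log (P i j) - P i j * u j +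
            P i j * (c + u i + 1)) := fun j => by ring
      simp only [h4, ← Finset.mul_sum, Finset.sum_add_distrib, Finset.sum_sub_distrib,
        ← Finset.sum_mul, hm.sum_row_eq_one]
      rw [show (∑ j, P i j * Real.log (P i j) - ∑ j, P i j * u j + 1 * (c + u i + 1)) = 1 by
        linarith, mul_one]
    rw [← Real.exp_add, ← sub_eq_add_neg, ← hsum]
    exact Finset.sum_le_sum fun j _ => hterm j
  obtain ⟨y, hy⟩ := Finite.exists_max (fun j => Real.exp (-u j))
  set V := Real.exp (-u y)
  have hV : 0 < V := Real.exp_pos _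
  set κ := (∑ i, p i ^ 2 * Real.exp (-u i)) / V with hκ
  have hκ0 : 0 < κ := by
    have : ∃ i, p i ≠ 0 := by
      by_contra! h
      simpa [h] using hm.sum_eq_one
    obtain ⟨i, hi⟩ := this
    refine div_pos (Finset.sum_pos' (fun j _ => by positivity) ⟨i, Finset.mem_univ i, ?_⟩) hV
    have := sq_pos_of_ne_zero hi
    positivity
  let Z : ℕ → ℝ := fun n => ∑ w : Fin n → Fin ℓ,
    if m.real (adicInterval w) = 0 then 0 else m.real (adicInterval w) ^ (2 : ℝ)
  have hZ : ∀ n : ℕ, Real.exp (-c) ^ n * κ ≤ Z (n + 1) := by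
    intro n
    have h1 := le_sum_wordWeight (p := fun i => p i ^ 2) (fun i => sq_nonneg _)
      (fun i j => sq_nonneg (P i j)) (Real.exp_nonneg _) hQ n
    have h2 : ∀ w : Fin (n + 1) → Fin ℓ, wordWeight (fun i => p i ^ 2) Q w =
        if m.real (adicInterval w) = 0 then 0 else m.real (adicInterval w) ^ (2 : ℝ) := by
      intro w
      have h3 : wordWeight (fun i => p i ^ 2) Q w = wordWeight p P w ^ 2 := by
        simp only [wordWeight, Q, Matrix.of_apply, mul_pow, Finset.prod_pow]
      rw [h3, hm.real_adicInterval, Real.rpow_two]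
      split_ifs with h
      · simp [h]
      · rfl
    rw [hκ, ← mul_div_assoc, div_le_iff₀ hV, Finset.sum_mul]
    refine h1.trans (Finset.sum_le_sum fun w _ => ?_)
    rw [← h2]
    exact mul_le_mul_of_nonneg_left (hy _)
      (wordWeight_nonneg (fun i => sq_nonneg _) (fun i j => sq_nonneg (P i j)) w)
  have hlim : Tendsto (fun n : ℕ => (-(n : ℝ) * c + Real.log κ) / (((n + 1 : ℕ) : ℝ) * Real.log ℓ))
      atTop (𝓝 (-(c / Real.log ℓ))) := by
    have h1 : Tendsto (fun n : ℕ => (c + Real.log κ) / ((n + 1 : ℕ) : ℝ)) atTop (𝓝 0) :=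
      (tendsto_const_div_atTop_nhds_zero_nat _).comp (tendsto_add_atTop_nat 1)
    have h2 := (h1.div_const (Real.log ℓ)).sub_const (c / Real.log ℓ)
    rw [zero_div, zero_sub] at h2
    refine h2.congr fun n => ?_
    have hn : ((n + 1 : ℕ) : ℝ) ≠ 0 := by positivity
    field_simp
    push_cast
    ring
  have hlim' := (continuous_coe_real_ereal.tendsto _).comp hlim
  rw [← hlim'.limsup_eq]
  have hshift : tau ℓ m 2 = limsup (fun n : ℕ =>
      ((1 / (((n + 1 : ℕ) : ℝ) * Real.log ℓ) * Real.log (Z (n + 1)) : ℝ) : EReal)) atTop := by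
    exact (limsup_nat_add (fun n : ℕ =>
      ((1 / ((n : ℝ) * Real.log ℓ) * Real.log (Z n) : ℝ) : EReal)) 1).symm
  rw [hshift]
  refine limsup_le_limsup (Eventually.of_forall fun n => ?_)
  simp only [Function.comp]
  refine EReal.coe_le_coe_iff.2 ?_
  rw [one_div_mul_eq_div]
  refine div_le_div_of_nonneg_right ?_ (by positivity)
  have h3 := Real.log_le_log (by positivity) (hZ n)
  rw [Real.log_mul (by positivity) hκ0.ne', Real.log_pow, Real.log_exp] at h3
  linarith

end CantorSet


/-! ### The spectral radius and the support -/

theorem exists_unique_perronVector {ℓ : ℕ} [NeZero ℓ] {A : Matrix (Fin ℓ) (Fin ℓ) ℝ}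
    (hA : A.IsIrreducible) :
    ∃ v, IsPerronVector A v ∧ (∀ w, IsPerronVector A w → w = v) ∧ ∀ i, 0 < v i := by
  obtain ⟨t, v, hv, hvt, hmax⟩ := exists_maximal_eigenvector hA
  have hspec := specRadius_eq hA.nonneg hv hvt hmax
  refine ⟨v, ⟨hv, by rw [hspec, hvt]⟩, fun w hw => ?_, ?_⟩
  · exact eq_of_mulVec_eq_smul hA hv hw.1 hvt (by rw [hw.2, hspec])
  · refine pos_of_mulVec_eq_smul hA (fun i => hv.1 i) ?_ hvt
    rintro rfl
    simpa using hv.2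

theorem specRadius_pos {ℓ : ℕ} [NeZero ℓ] {A : Matrix (Fin ℓ) (Fin ℓ) ℝ}
    (hA : ∀ i j, 0 ≤ A i j) (hrow : ∀ i, ∃ j, A i j ≠ 0) {v : Fin ℓ → ℝ} (hv : ∀ i, 0 < v i)
    (h : A.mulVec v = specRadius A • v) : 0 < specRadius A := by
  obtain ⟨j, hj⟩ := hrow 0
  have h1 : 0 < specRadius A * v 0 := by
    rw [show specRadius A * v 0 = A.mulVec v 0 from (congrFun h 0).symm]
    exact Finset.sum_pos' (fun k _ => mul_nonneg (hA 0 k) (hv k).le)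
      ⟨j, Finset.mem_univ j, mul_pos (lt_of_le_of_ne (hA 0 j) (Ne.symm hj)) (hv j)⟩
  exact pos_of_mul_pos_left h1 (hv 0).le

theorem IsMarkovMeasure.one_lt {ℓ : ℕ} {m : Measure ℝ} {p : Fin ℓ → ℝ}
    {P : Matrix (Fin ℓ) (Fin ℓ) ℝ} (hm : IsMarkovMeasure m p P) (hP1 : ∀ i j, P i j ≠ 1) :
    1 < ℓ := by
  have := hm.neZero
  by_contra h
  obtain rfl : ℓ = 1 := by have := NeZero.pos ℓ; lia
  exact hP1 0 0 (by simpa using hm.sum_row_eq_one 0)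

/-- If the support of the Markov measure is the Cantor set, the admissible words for `p₀` and `P₀`
have positive weight for `p` and `P`. The words admissible for `P₀` are seen through an auxiliary
Markov measure `m₀` with transition matrix `N` on the Cantor set. -/
theorem wordWeight_ne_zero_of_support {ℓ : ℕ} {m m₀ : Measure ℝ} {p p₀ q : Fin ℓ → ℝ}
    {P P₀ N : Matrix (Fin ℓ) (Fin ℓ) ℝ} (hm : IsMarkovMeasure m p P) (hP1 : ∀ i j, P i j ≠ 1)
    (hsupp : m.support = cantorSet p₀ P₀) (hm₀ : IsMarkovMeasure m₀ q N) (hN1 : ∀ i j, N i j ≠ 1)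
    (hq : ∀ (n : ℕ) (w : Fin (n + 1) → Fin ℓ), wordWeight q N w ≠ 0 ↔ wordWeight p₀ P₀ w = 1)
    (n : ℕ) (w : Fin (n + 1) → Fin ℓ) (hw : wordWeight p₀ P₀ w = 1) : wordWeight p P w ≠ 0 := by
  have hprob := hm.isProbabilityMeasure
  obtain ⟨x, hx, hxK⟩ := hm₀.exists_mem_interior hN1 ((hq n w).2 hw)
    (hm₀.ae_mem_cantorSet fun n w h => (hq n w).1 h)
  rw [← hsupp] at hxK
  have h1 := (Measure.mem_support_iff_forall x).1 hxK _ (isOpen_interior.mem_nhds hx)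
  rw [hm.measure_interior_adicInterval hP1] at h1
  rw [← hm.real_adicInterval]
  exact (ENNReal.toReal_pos h1.ne' (measure_ne_top _ _)).ne'

end MarkovMeasure

/-! ### The dichotomy -/

open MarkovMeasure in
theorem mainTheorem3 {ℓ : ℕ}
    -- the 0-1 matrix and the nonzero 0-1 vector defining the compact set
    (P₀ : Matrix (Fin ℓ) (Fin ℓ) ℝ) (hP₀ : ∀ i j, P₀ i j = 0 ∨ P₀ i j = 1)
    (hP₀irr : P₀.IsIrreducible)
    (p₀ : Fin ℓ → ℝ) (hp₀ : ∀ i, p₀ i = 0 ∨ p₀ i = 1) (hp₀ne : p₀ ≠ 0)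
    -- the Markov chain
    {Ω : Type*} [MeasurableSpace Ω] (μ : MeasureTheory.Measure Ω)
    [MeasureTheory.IsProbabilityMeasure μ]
    (X : ℕ → Ω → Fin ℓ) (p : Fin ℓ → ℝ) (P : Matrix (Fin ℓ) (Fin ℓ) ℝ)
    (hX : MarkovMeasure.IsMarkovChain μ X p P)
    (hPirr : P.IsIrreducible) (hP1 : ∀ i j, P i j ≠ 1)
    -- the measure driven by the chain
    (m : MeasureTheory.Measure ℝ) (hm : MarkovMeasure.IsDrivenBy m μ X)
    (hsupp : m.support = MarkovMeasure.cantorSet p₀ P₀) :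
    ∃ π₀ : Fin ℓ → ℝ,
      -- the vector is the unique Perron probability vector; its entries are positive
      (MarkovMeasure.IsPerronVector P₀ π₀ ∧
        ∀ π, MarkovMeasure.IsPerronVector P₀ π → π = π₀) ∧
      (∀ i, 0 < π₀ i) ∧
      -- the measure has a dimension, and it is maximal in exactly one case
      (∃ d, MarkovMeasure.HasDim m d) ∧
      (MarkovMeasure.HasDim m (dimH (MarkovMeasure.cantorSet p₀ P₀)) ↔
        P = MarkovMeasure.normalized P₀ π₀) ∧
      -- this is the only monofractal case
      (MarkovMeasure.IsMonofractal m ↔ P = MarkovMeasure.normalized P₀ π₀) ∧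
      (P ≠ MarkovMeasure.normalized P₀ π₀ →
        -((dimH (MarkovMeasure.cantorSet p₀ P₀) : ENNReal) : EReal) < MarkovMeasure.tau ℓ m 2 ∧
          MarkovMeasure.IsMultifractal m) := by
  have hM := hX.isMarkovMeasure hm
  have hprob := hM.isProbabilityMeasure
  have hne := hM.neZero
  have hℓ := hM.one_lt hP1
  have hlog : 0 < Real.log ℓ := Real.log_pos (by exact_mod_cast hℓ)
  -- Words of positive mass are admissible for `p₀` and `P₀`.
  have hle : ∀ (n : ℕ) (w : Fin (n + 1) → Fin ℓ), wordWeight p P w ≠ 0 →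
      wordWeight p₀ P₀ w = 1 := fun n w hw => by
    obtain ⟨x, hx, hxK⟩ := hM.exists_mem_interior hP1 hw Measure.support_mem_ae
    exact wordWeight_eq_one_of_mem_interior hx (hsupp ▸ hxK)
  have hpne : ∃ i, p i ≠ 0 := by
    by_contra! h
    simpa [h] using hM.sum_eq_one
  have hPP₀ := matrix_ne_zero_of_wordWeight hPirr hpne
    fun n w hw => (wordWeight_eq_one_iff hp₀ hP₀ w).1 (hle n w hw)
  have hPP₀' : ∀ i j, P i j ≠ 0 → P₀ i j = 1 := fun i j h => (hP₀ i j).resolve_left (hPP₀ i j h)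
  -- The Perron data of `P₀` and the normalized matrix `N`.
  obtain ⟨v, hv, huniq, hvpos⟩ := exists_unique_perronVector hP₀irr
  set t := specRadius P₀ with ht
  have hrow : ∀ i, ∃ j, P i j ≠ 0 := fun i => by
    by_contra! h
    simpa [h] using hM.sum_row_eq_one i
  have ht0 : 0 < t := specRadius_pos hP₀irr.nonneg
    (fun i => (hrow i).imp fun j hj => hPP₀ i j hj) hvpos hv.2
  set N := normalized P₀ v with hNdef
  have hN : ∀ i j, N i j = P₀ i j * v j / (t * v i) := normalized_apply hvpos
  have hN0 := normalized_nonneg hP₀irr.nonneg ht0 hvpos hN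
  have hNsum := sum_normalized ht0 hvpos hv.2 hN
  have hNP := normalized_ne_zero_iff ht0 hvpos hN
  have hNirr := isIrreducible_of_ne_zero_iff hP₀irr hN0 hNP
  have hN1 := ne_one_of_support hN0 hNsum hM.sum_row_eq_one hP1
    fun i j h => (hNP i j).2 (hPP₀ i j h)
  -- The auxiliary measure `m₀` of maximal dimension on the Cantor set.
  have hp₀0 : ∀ i, 0 ≤ p₀ i := fun i => by rcases hp₀ i with h | h <;> simp [h]
  set s := ∑ i, p₀ i with hs
  have hs0 : 0 < s := by
    obtain ⟨i, hi⟩ := Function.ne_iff.1 hp₀ne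
    exact Finset.sum_pos' (fun j _ => hp₀0 j)
      ⟨i, Finset.mem_univ i, lt_of_le_of_ne (hp₀0 i) (Ne.symm hi)⟩
  obtain ⟨m₀, hm₀⟩ := exists_isMarkovMeasure (q := fun i => p₀ i / s) hℓ
    (fun i => div_nonneg (hp₀0 i) hs0.le) (by rw [← Finset.sum_div, ← hs, div_self hs0.ne'])
    hN0 hNsum hN1
  have hq : ∀ (n : ℕ) (w : Fin (n + 1) → Fin ℓ),
      wordWeight (fun i => p₀ i / s) N w ≠ 0 ↔ wordWeight p₀ P₀ w = 1 := fun n w => by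
    rw [wordWeight_eq_one_iff hp₀ hP₀, wordWeight_ne_zero_iff, wordWeight_ne_zero_iff]
    simp only [hNP, ne_eq, div_eq_zero_iff, hs0.ne', or_false]
  have hge := wordWeight_ne_zero_of_support hM hP1 hsupp hm₀ hN1 hq
  have hwN : ∀ (n : ℕ) (w : Fin (n + 1) → Fin ℓ),
      wordWeight (fun i => p₀ i / s) N w ≠ 0 → wordWeight p P w ≠ 0 :=
    fun n w h => hge n w ((hq n w).1 h)
  have hqne : ∃ i, p₀ i / s ≠ 0 := by
    by_contra! h
    simpa [h] using hm₀.sum_eq_one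
  have hNP' := matrix_ne_zero_of_wordWeight hNirr hqne hwN
  have hqp := vec_ne_zero_of_wordWeight hwN
  have hPA : ∀ i j, P i j ≠ 0 ↔ P₀ i j = 1 := fun i j =>
    ⟨hPP₀' i j, fun h => hNP' i j ((hNP i j).2 (by rw [h]; exact one_ne_zero))⟩
  -- The entropy `c` of `P`, and the cross entropy `c'` of `N` relative to `P`.
  obtain ⟨c, u, hc⟩ := exists_isPoissonSolution hPirr hM.sum_row_eq_one
    (fun i => ∑ j, P i j * -Real.log (P i j))
  obtain ⟨c', u', hc'⟩ := exists_isPoissonSolution hNirr hNsum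
    (fun i => ∑ j, N i j * -Real.log (P i j))
  have hc0 := entropy_pos hM.matrix_nonneg hM.sum_row_eq_one hP1 hc
  obtain ⟨hct, hceq⟩ := entropy_le_log hP₀ ht0 hvpos hN hNsum hPirr hM.sum_row_eq_one hPP₀' hc
  have hcc' := log_le_cross_entropy hP₀ ht0 hvpos hN hNsum hM.matrix_nonneg hM.sum_row_eq_one
    hPA hc'
  have hlogt : 0 < Real.log t := hc0.trans_le hct
  have ht1 : 1 ≤ t := by
    by_contra h
    exact (Real.log_nonpos ht0.le (not_le.1 h).le).not_gt hlogt
  -- The dimensions of `m` and of the Cantor set.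
  have hdim := hM.hasDim hℓ hPirr hP1 hc0.le hc
  have hcN := isPoissonSolution_entropy_normalized hP₀ ht0 hvpos hv.2 hN
  have hprob₀ := hm₀.isProbabilityMeasure
  have hm₀ae : ∀ E : Set ℝ, (∀ᵐ x ∂m₀, x ∈ E) →
      ENNReal.ofReal (Real.log t / Real.log ℓ) ≤ dimH E := by
    intro E hE
    refine le_dimH_of_ae_localDim (m := m₀) (fun h0 => ?_)
      ((hm₀.ae_localDim hm₀ hℓ hNirr hN1 (fun _ h => h) (fun _ _ h => h) hcN).mono
        fun x hx => hx.2.2.2.2)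
    obtain ⟨x, hx, hx'⟩ := (hE.and (measure_eq_zero_iff_ae_notMem.1 h0)).exists
    exact hx' hx
  have hK : dimH (cantorSet p₀ P₀) = ENNReal.ofReal (Real.log t / Real.log ℓ) :=
    le_antisymm (dimH_cantorSet_le hℓ hp₀ hP₀ ht1 hvpos hv.2)
      (hm₀ae _ (hm₀.ae_mem_cantorSet fun n w h => (hq n w).1 h))
  have hclt : P ≠ N → c / Real.log ℓ < Real.log t / Real.log ℓ := fun h =>
    div_lt_div_of_pos_right (lt_of_le_of_ne hct fun h' => h (hceq h')) hlog
  have hmulti : P ≠ N → IsMultifractal m := by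
    intro hPN
    refine ⟨c / Real.log ℓ, c' / Real.log ℓ, ?_, ?_, ?_⟩
    · exact ((hclt hPN).trans_le (div_le_div_of_nonneg_right hcc' hlog.le)).ne
    · have hae := hM.ae_localDim hM hℓ hPirr hP1 (fun _ h => h) (fun _ _ h => h) hc
      refine (ENNReal.ofReal_pos.2 (div_pos hc0 hlog)).trans_le (le_dimH_of_ae_localDim (m := m)
        (fun h0 => ?_) (hae.mono fun x hx => hx.2.2.2.2))
      obtain ⟨x, hx, hx'⟩ := (hae.and (measure_eq_zero_iff_ae_notMem.1 h0)).exists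
      exact hx' hx.2.2.2
    · exact (ENNReal.ofReal_pos.2 (div_pos hlogt hlog)).trans_le (hm₀ae _
        ((hm₀.ae_localDim hM hℓ hNirr hN1 hqp hNP' hc').mono fun x hx => hx.2.2.2))
  refine ⟨v, ⟨hv, huniq⟩, hvpos, ⟨_, hdim⟩, ⟨fun h => ?_, fun h => ?_⟩, ⟨fun h => ?_, fun h => ?_⟩,
    fun hPN => ⟨?_, hmulti hPN⟩⟩
  · by_contra hPN
    have h1 := hdim.1.symm.trans h.1
    rw [hK] at h1
    exact ((ENNReal.ofReal_lt_ofReal_iff (div_pos hlogt hlog)).2 (hclt hPN)).ne h1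
  · have hPN : P = N := h
    rw [hK]
    rw [hPN] at hM
    exact hM.hasDim hℓ hNirr hN1 hlogt.le hcN
  · by_contra hPN
    obtain ⟨a, b, hab, ha, hb⟩ := hmulti hPN
    obtain ⟨α, hα⟩ := h
    have huq : ∀ a, 0 < dimH (levelSet m a) → a = α := by
      intro a ha
      obtain ⟨x, hx⟩ : (levelSet m a).Nonempty := by
        by_contra he
        rw [not_nonempty_iff_eq_empty.1 he, dimH_empty] at ha
        exact ha.false
      have hx' : x ∈ levelSet m α := hα ▸ hx.1
      exact tendsto_nhds_unique hx.2 hx'.2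
    exact hab ((huq a ha).trans (huq b hb).symm)
  · have hPN : P = N := h
    obtain ⟨a, b, ha, hb, hab⟩ := exists_bounds_wordWeight_normalized hM.nonneg hM.le_one hP₀ ht0
      hvpos hN
    refine ⟨Real.log t / Real.log ℓ, Subset.antisymm (fun x hx => hx.1) fun x hx => ?_⟩
    rw [← hPN] at hab
    exact hM.mem_levelSet_of_bounds hℓ hsupp ht0 ha hb (fun n w => (hab n w).1)
      (fun n w hw => (hab n w).2 (hge n w hw)) hx
  · refine lt_of_lt_of_le ?_ (hM.le_tau_two hℓ hc)
    rw [hK, EReal.coe_ennreal_ofReal, max_eq_left (div_pos hlogt hlog).le, ← EReal.coe_neg]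
    exact EReal.coe_lt_coe_iff.2 (neg_lt_neg (hclt hPN))
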